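/- Let $\mu$ be a dominating measure on a measurable space $\mathcal X$, let $\Theta\subset\mathbb R^p$, and let $\{f_\theta:\theta\in\Theta\}$ be a family of probability densities with respect to $\mu$. Fix $\beta\ge 0$ and $\theta_0\in\Theta$. Write $u_\theta(x)=\frac{\partial}{\partial\theta}\log f_\theta(x)$, $I_\theta(x)=-\frac{\partial}{\partial\theta^T}u_\theta(x)$ and, for a density $g$, $$J_\beta(\theta)=\int u_\theta u_\theta^T f_\theta^{1+\beta}\,d\mu+\int (I_\theta-\beta u_\theta u_\theta^T)(g-f_\theta)f_\theta^\beta\,d\mu,$$ $$K_\beta(\theta)=\int u_\theta u_\theta^T f_\theta^{2\beta}g\,d\mu-\xi_\beta(\theta)\xi_\beta(\theta)^T,\qquad \xi_\beta(\theta)=\int u_\theta f_\theta^\beta g\,d\mu .$$ Put $V_\theta(x)=\int f_\theta^{1+\beta}d\mu-(1+\frac1\beta)f_\theta^\beta(x)$ if $\beta>0$ and $V_\theta(x)=-\log f_\theta(x)$ if $\beta=0$. Let $g=f_{\theta_0}$ be the true density (the null hypothesis $H_0:\theta=\theta_0$) and assume: (D1) the set $\{x: f_\theta(x)>0\}$ is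 the same for all $\theta\in\Theta$; (D2) there is an open set $\omega\subset\Theta$ containing $\theta_0$ such that, for almost all $x$, $f_\theta(x)$ is three times continuously differentiable with respect to $\theta\in\omega$; (D3) on $\omega$, the integrals $\int f_\theta^{1+\beta}d\mu$ and $\int f_\theta^\beta g\,d\mu$ can be differentiated three times with respect to $\theta$, and the derivatives can be taken under the integral sign; (D4) the matrix $J_\beta(\theta_0)$ is positive definite; (D5) there is a function $M$ with $\int M g\,d\mu<\infty$ such that, for almost all $x$ with $g(x)>0$, the third order derivative of $V_\theta(x)$ with respect to $\theta$ is bounded in norm by $M(x)$ for all $\theta\in\omega$; and that the integrals defining $K_\beta(\theta_0)$ are finite and $K_\beta(\theta_0)$ is nonsingular. Let $X_1,X_2,\dots$ be independent with common density $f_{\theta_0}$. Then the estimating equation $$\frac1n\sum_{i=1}^n u_\theta(X_i)f_\theta^\beta(X_i)-\int u_\theta f_\theta^{1+\beta}\,d\mu=0$$ has a consistent sequence of roots, that is, there are estimators $\hat\theta_n=\hat\theta_n(X_1,\dots,X_n)$ with $\hat\theta_n\to\theta_0$ in probability which, with probability tending to one, lie in $\Theta$ and solve the equation. Moreover, let $\hat\theta_\beta=\hat\theta_n$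 be any such minimum density power divergence estimator, i.e. any consistent sequence of estimators that, with probability tending to one, lie in $\Theta$ and solve the estimating equation, or any consistent sequence of estimators that, with probability tending to one, minimize $\frac1n\sum_{i=1}^nV_\theta(X_i)$ over $\theta\in\Theta$. Then $$W_n=n(\hat\theta_\beta-\theta_0)^T\big(J_\beta^{-1}(\theta_0)K_\beta(\theta_0)J_\beta^{-1}(\theta_0)\big)^{-1}(\hat\theta_\beta-\theta_0)$$ converges in distribution, as $n\to\infty$, to the chi-square distribution with $p$ degrees of freedom. -/

import Mathlib

open MeasureTheory ProbabilityTheory Filter Topology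

noncomputable section

namespace WaldDPD

/-- The chi-square distribution with `p` degrees of freedom: the law of `‖Z‖²`, where `Z` is a
standard Gaussian vector of `ℝᵖ`. -/
def chiSquared (p : ℕ) : Measure ℝ :=
  (stdGaussian (EuclideanSpace ℝ (Fin p))).map (fun z => ‖z‖ ^ 2)

instance isProbabilityMeasure_chiSquared (p : ℕ) : IsProbabilityMeasure (chiSquared p) :=
  Measure.isProbabilityMeasure_map (by fun_prop)

variable {p : ℕ} {𝓧 : Type*}

/-- The score function `u_θ(x) = ∂/∂θ log f_θ(x)`. -/
def score (f : EuclideanSpace ℝ (Fin p) → 𝓧 → ℝ) (θ : EuclideanSpace ℝ (Fin p)) (x : 𝓧) :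
    EuclideanSpace ℝ (Fin p) :=
  gradient (fun t => Real.log (f t x)) θ

/-- The information function `I_θ(x) = - ∂/∂θᵀ u_θ(x)`. -/
def infoFun (f : EuclideanSpace ℝ (Fin p) → 𝓧 → ℝ) (θ : EuclideanSpace ℝ (Fin p)) (x : 𝓧) :
    Matrix (Fin p) (Fin p) ℝ :=
  Matrix.of fun i j =>
    -(fderiv ℝ (fun t => score f t x) θ (EuclideanSpace.single j 1)) i

variable [MeasurableSpace 𝓧]

/-- The matrix `J_β(θ)` for the model `f` and the true density `g`. -/
def matJ (f : EuclideanSpace ℝ (Fin p) → 𝓧 → ℝ) (μ : Measure 𝓧) (β : ℝ) (g : 𝓧 → ℝ)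
    (θ : EuclideanSpace ℝ (Fin p)) : Matrix (Fin p) (Fin p) ℝ :=
  Matrix.of fun i j =>
    (∫ x, score f θ x i * score f θ x j * f θ x ^ (1 + β) ∂μ)
      + ∫ x, (infoFun f θ x i j - β * (score f θ x i * score f θ x j))
          * (g x - f θ x) * f θ x ^ β ∂μ

/-- The vector `ξ_β(θ) = ∫ u_θ f_θ^β g`. -/
def vecXi (f : EuclideanSpace ℝ (Fin p) → 𝓧 → ℝ) (μ : Measure 𝓧) (β : ℝ) (g : 𝓧 → ℝ)
    (θ : EuclideanSpace ℝ (Fin p)) (i : Fin p) : ℝ :=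
  ∫ x, score f θ x i * f θ x ^ β * g x ∂μ

/-- The matrix `K_β(θ)` for the model `f` and the true density `g`. -/
def matK (f : EuclideanSpace ℝ (Fin p) → 𝓧 → ℝ) (μ : Measure 𝓧) (β : ℝ) (g : 𝓧 → ℝ)
    (θ : EuclideanSpace ℝ (Fin p)) : Matrix (Fin p) (Fin p) ℝ :=
  Matrix.of fun i j =>
    (∫ x, score f θ x i * score f θ x j * f θ x ^ (2 * β) * g x ∂μ)
      - vecXi f μ β g θ i * vecXi f μ β g θ j

/-- The integrand `V_θ(x)` of the empirical objective function; `-log f_θ(x)` for `β = 0`. -/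
def lossV (f : EuclideanSpace ℝ (Fin p) → 𝓧 → ℝ) (μ : Measure 𝓧) (β : ℝ)
    (θ : EuclideanSpace ℝ (Fin p)) (x : 𝓧) : ℝ :=
  if β = 0 then -Real.log (f θ x)
  else (∫ y, f θ y ^ (1 + β) ∂μ) - (1 + 1 / β) * f θ x ^ β

/-- The empirical objective function `n⁻¹ ∑ V_θ(x_i)`. -/
def empObjective (f : EuclideanSpace ℝ (Fin p) → 𝓧 → ℝ) (μ : Measure 𝓧) (β : ℝ) {n : ℕ}
    (x : Fin n → 𝓧) (θ : EuclideanSpace ℝ (Fin p)) : ℝ :=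
  (1 / (n : ℝ)) * ∑ i, lossV f μ β θ (x i)

/-- The left side of the estimating equation:
`n⁻¹ ∑ u_θ(x_i) f_θ^β(x_i) - ∫ u_θ f_θ^{1+β}`, by coordinates. -/
def estimatingFun (f : EuclideanSpace ℝ (Fin p) → 𝓧 → ℝ) (μ : Measure 𝓧) (β : ℝ) {n : ℕ}
    (x : Fin n → 𝓧) (θ : EuclideanSpace ℝ (Fin p)) (k : Fin p) : ℝ :=
  (1 / (n : ℝ)) * (∑ i, score f θ (x i) k * f θ (x i) ^ β)
    - ∫ y, score f θ y k * f θ y ^ (1 + β) ∂μ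

/-- `f` is a family of probability densities with respect to `μ`, indexed by `Θ`. -/
structure IsDensityModel (f : EuclideanSpace ℝ (Fin p) → 𝓧 → ℝ) (μ : Measure 𝓧)
    (Θ : Set (EuclideanSpace ℝ (Fin p))) : Prop where
  measurable : ∀ θ ∈ Θ, Measurable (f θ)
  nonneg : ∀ θ ∈ Θ, ∀ x, 0 ≤ f θ x
  lintegral_eq_one : ∀ θ ∈ Θ, ∫⁻ x, ENNReal.ofReal (f θ x) ∂μ = 1

/-- On the open set `ω`, the integral `∫ F_θ(x) dμ(x)` can be differentiated three times with
respect to `θ`, and the derivatives can be taken under the integral sign. -/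
structure DiffThriceUnderIntegral (F : EuclideanSpace ℝ (Fin p) → 𝓧 → ℝ) (μ : Measure 𝓧)
    (ω : Set (EuclideanSpace ℝ (Fin p))) : Prop where
  integrable : ∀ k : ℕ, k ≤ 3 → ∀ θ ∈ ω,
    Integrable (fun x => iteratedFDeriv ℝ k (fun t => F t x) θ) μ
  hasFDerivAt : ∀ k : ℕ, k < 3 → ∀ θ ∈ ω,
    HasFDerivAt (fun t => ∫ x, iteratedFDeriv ℝ k (fun s => F s x) t ∂μ)
      (∫ x, fderiv ℝ (iteratedFDeriv ℝ k (fun s => F s x)) θ ∂μ) θ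

/-- The regularity conditions of minimum density power divergence estimation, for the model `f`
on `Θ`, the true density `g` and the best fitting parameter `θg`. -/
structure RegularityConditions (f : EuclideanSpace ℝ (Fin p) → 𝓧 → ℝ) (μ : Measure 𝓧)
    (Θ : Set (EuclideanSpace ℝ (Fin p))) (β : ℝ) (g : 𝓧 → ℝ)
    (θg : EuclideanSpace ℝ (Fin p)) (ω : Set (EuclideanSpace ℝ (Fin p))) : Prop where
  /-- All model densities and the true density have the same support. -/
  common_support : ∀ θ ∈ Θ, ∀ x, 0 < f θ x ↔ 0 < g x
  isOpen : IsOpen ω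
  subset : ω ⊆ Θ
  mem : θg ∈ ω
  /-- Almost every `θ ↦ f_θ(x)` is three times continuously differentiable on `ω`. -/
  smooth : ∀ᵐ x ∂μ, ContDiffOn ℝ 3 (fun θ => f θ x) ω
  diff_integral_model : DiffThriceUnderIntegral (fun θ x => f θ x ^ (1 + β)) μ ω
  diff_integral_cross : DiffThriceUnderIntegral (fun θ x => f θ x ^ β * g x) μ ω
  posDef : (matJ f μ β g θg).PosDef
  /-- The third derivatives of `V_θ` are dominated on `ω` by a function of finite mean. -/
  dominated : ∃ M : 𝓧 → ℝ, Integrable (fun x => M x * g x) μ ∧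
    ∀ᵐ x ∂μ, 0 < g x → ∀ θ ∈ ω,
      ‖iteratedFDeriv ℝ 3 (fun t => lossV f μ β t x) θ‖ ≤ M x

variable {Ω : Type*} [MeasurableSpace Ω]

/-- The first `n` observations. -/
def sample (X : ℕ → Ω → 𝓧) (n : ℕ) (w : Ω) : Fin n → 𝓧 := fun i => X i w

/-- `T` is a sequence of (measurable) estimators that is consistent for `θ₀` and for which
`T n`, with probability tending to one, lies in `Θ` and has the property `Q` relative to the
sample. -/
structure IsConsistentSeq (Q : (n : ℕ) → (Fin n → 𝓧) → EuclideanSpace ℝ (Fin p) → Prop)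
    (Θ : Set (EuclideanSpace ℝ (Fin p))) (θ₀ : EuclideanSpace ℝ (Fin p)) (P : Measure Ω)
    (X : ℕ → Ω → 𝓧) (T : (n : ℕ) → (Fin n → 𝓧) → EuclideanSpace ℝ (Fin p)) : Prop where
  measurable : ∀ n, Measurable (T n)
  tendsto_prob : Tendsto
    (fun n => P {w | ¬ (T n (sample X n w) ∈ Θ ∧ Q n (sample X n w) (T n (sample X n w)))})
    atTop (𝓝 0)
  consistent : TendstoInMeasure P (fun n w => T n (sample X n w)) atTop (fun _ => θ₀)

/-- A consistent sequence of roots of the estimating equation. -/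
def IsConsistentRootSeq (f : EuclideanSpace ℝ (Fin p) → 𝓧 → ℝ) (μ : Measure 𝓧)
    (Θ : Set (EuclideanSpace ℝ (Fin p))) (β : ℝ) (θ₀ : EuclideanSpace ℝ (Fin p))
    (P : Measure Ω) (X : ℕ → Ω → 𝓧)
    (T : (n : ℕ) → (Fin n → 𝓧) → EuclideanSpace ℝ (Fin p)) : Prop :=
  IsConsistentSeq (fun _ x θ => estimatingFun f μ β x θ = 0) Θ θ₀ P X T

/-- A consistent sequence of minimizers over `Θ` of the empirical objective function. -/
def IsConsistentMinimizerSeq (f : EuclideanSpace ℝ (Fin p) → 𝓧 → ℝ) (μ : Measure 𝓧)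
    (Θ : Set (EuclideanSpace ℝ (Fin p))) (β : ℝ) (θ₀ : EuclideanSpace ℝ (Fin p))
    (P : Measure Ω) (X : ℕ → Ω → 𝓧)
    (T : (n : ℕ) → (Fin n → 𝓧) → EuclideanSpace ℝ (Fin p)) : Prop :=
  IsConsistentSeq (fun _ x θ => IsMinOn (empObjective f μ β x) Θ θ) Θ θ₀ P X T

/-- The Wald-type statistic `n (θ̂ - θ₀)ᵀ (J⁻¹ K J⁻¹)⁻¹ (θ̂ - θ₀)`. -/
def waldStat (J K : Matrix (Fin p) (Fin p) ℝ) (θ₀ : EuclideanSpace ℝ (Fin p)) (n : ℕ)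
    (θ : EuclideanSpace ℝ (Fin p)) : ℝ :=
  (n : ℝ) * ((θ - θ₀).ofLp ⬝ᵥ ((J⁻¹ * K * J⁻¹)⁻¹).mulVec (θ - θ₀).ofLp)

end WaldDPD

end

/-! Up to the factor `-(1 + β)`, the estimating function is the gradient of the empirical objective.
By the bound on third derivatives and the law of large numbers, for every δ there is a ball about θ₀
on which, with probability tending to one, it differs from a fixed linear map by a δ-Lipschitz
error; at θ₀ it tends to 0. A map Lipschitz-close to an invertible linear map is injective and
covers a ball around its central value. This gives a root near θ₀ (`exists_consistent_roots`) and
shows that √n A(θ̂ - θ₀) equals -√n times the empirical mean at θ₀ up to a negligible term, for any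
consistent root (`tendstoInDistribution_roots`).

The mean derivative comes from `smul_fderiv_fderiv_powerLink`: with B = `powerLink β`, f D²B(f) =
D²f^(1+β) - (1+β) f^(1+β) u uᵀ. Integrated at θ₀, the first term on the right cancels the Hessian of
∫ f^(1+β), and the centred score has mean derivative -J. Its covariance is K. If R whitens K, then R
applied to the centred score obeys a central limit theorem with standard Gaussian limit, and the
Wald statistic is exactly ‖√n R J (θ̂ - θ₀)‖²; the continuous mapping theorem concludes. A
consistent minimizer is eventually interior with high probability, hence a root. -/

noncomputable section

set_option maxSynthPendingDepth 3

namespace WaldDPD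

/-! ### Calculus of events of probability tending to one. -/

section HighProbability

variable {Ω : Type*} [MeasurableSpace Ω]

/-- The events `Q n` hold with (outer) probability tending to one. -/
def WithHighProb (P : Measure Ω) (Q : ℕ → Ω → Prop) : Prop :=
  Tendsto (fun n => P {w | ¬ Q n w}) atTop (𝓝 0)

variable {P : Measure Ω} {Q R : ℕ → Ω → Prop}

/-- The implication is asked only almost surely, because sample points are regular only off a null
set, and only for large n, because n = 0 has to be excluded. No event needs to be measurable. -/
lemma WithHighProb.mono_ae (hQ : WithHighProb P Q)
    (h : ∀ᶠ n in atTop, ∀ᵐ w ∂P, Q n w → R n w) : WithHighProb P R := by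
  refine tendsto_of_tendsto_of_tendsto_of_le_of_le' tendsto_const_nhds hQ
    (Eventually.of_forall fun _ => zero_le) ?_
  filter_upwards [h] with n hn
  refine measure_mono_ae ?_
  filter_upwards [hn] with w hw hR hq
  exact hR (hw hq)

lemma WithHighProb.mono (hQ : WithHighProb P Q) (h : ∀ n w, Q n w → R n w) :
    WithHighProb P R :=
  hQ.mono_ae (Eventually.of_forall fun n => ae_of_all _ (h n))

lemma WithHighProb.and (hQ : WithHighProb P Q) (hR : WithHighProb P R) :
    WithHighProb P (fun n w => Q n w ∧ R n w) := by
  have h : Tendsto (fun n => P {w | ¬ Q n w} + P {w | ¬ R n w}) atTop (𝓝 0) := by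
    simpa using hQ.add hR
  refine tendsto_of_tendsto_of_tendsto_of_le_of_le tendsto_const_nhds h (fun _ => zero_le) ?_
  intro n
  refine (measure_mono ?_).trans (measure_union_le _ _)
  intro w hw
  simp only [Set.mem_union, Set.mem_ofPred_eq] at hw ⊢
  tauto

lemma tendstoInMeasure_iff_withHighProb {F : Type*} [SeminormedAddCommGroup F]
    {Y : ℕ → Ω → F} {c : Ω → F} :
    TendstoInMeasure P Y atTop c ↔
      ∀ ε : ℝ, 0 < ε → WithHighProb P (fun n w => ‖Y n w - c w‖ < ε) := by
  rw [tendstoInMeasure_iff_norm]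
  simp [WithHighProb, not_lt]

end HighProbability

/-! ### Law of large numbers and central limit theorem for samples. -/

section LimitTheorems

/-- The mean of `Y` over a finite sample. -/
def empMean {𝓧 F : Type*} [AddCommGroup F] [Module ℝ F] (Y : 𝓧 → F) {n : ℕ} (x : Fin n → 𝓧) : F :=
  (n : ℝ)⁻¹ • ∑ i, Y (x i)

lemma empMean_sample {𝓧 Ω F : Type*} [AddCommGroup F] [Module ℝ F] (X : ℕ → Ω → 𝓧)
    (Y : 𝓧 → F) (n : ℕ) (w : Ω) :
    empMean Y (sample X n w) = (n : ℝ)⁻¹ • ∑ i ∈ Finset.range n, Y (X i w) := by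
  rw [empMean, Finset.sum_range]
  rfl

variable {𝓧 Ω : Type*} [MeasurableSpace 𝓧] [MeasurableSpace Ω]

variable {P : Measure Ω} {ν : Measure 𝓧} {X : ℕ → Ω → 𝓧}

lemma ae_forall_sample (hX_law : ∀ i, HasLaw (X i) ν P) {q : 𝓧 → Prop} (hq : ∀ᵐ x ∂ν, q x) :
    ∀ᵐ w ∂P, ∀ i, q (X i w) := by
  rw [ae_all_iff]
  intro i
  have := (hX_law i).map_eq ▸ hq
  exact ae_of_ae_map (hX_law i).aemeasurable this

/-- Independence and equality of laws pass to compositions with measurable functions, while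
estimating functions are only a.e. measurable; almost surely no observation meets the exceptional
set. -/
lemma exists_measurable_comp {F : Type*} [MeasurableSpace F]
    (hX_law : ∀ i, HasLaw (X i) ν P) {Y : 𝓧 → F} (hY : AEMeasurable Y ν) :
    ∃ Y' : 𝓧 → F, Measurable Y' ∧ Y =ᵐ[ν] Y' ∧ ∀ᵐ w ∂P, ∀ i, Y (X i w) = Y' (X i w) :=
  ⟨hY.mk Y, hY.measurable_mk, hY.ae_eq_mk, ae_forall_sample hX_law hY.ae_eq_mk⟩

lemma aemeasurable_comp_sample {F : Type*} [MeasurableSpace F]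
    (hX_law : ∀ i, HasLaw (X i) ν P) {Y : 𝓧 → F} (hY : AEMeasurable Y ν) (i : ℕ) :
    AEMeasurable (fun w => Y (X i w)) P :=
  AEMeasurable.comp_aemeasurable ((hX_law i).map_eq.symm ▸ hY) (hX_law i).aemeasurable

lemma identDistrib_comp_sample {F : Type*} [MeasurableSpace F]
    (hX_law : ∀ i, HasLaw (X i) ν P) {Y : 𝓧 → F} (hY : Measurable Y) (i : ℕ) :
    IdentDistrib (fun w => Y (X i w)) (fun w => Y (X 0 w)) P P := by
  have : IdentDistrib (X i) (X 0) P P :=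
    ⟨(hX_law i).aemeasurable, (hX_law 0).aemeasurable, by rw [(hX_law i).map_eq, (hX_law 0).map_eq]⟩
  exact this.comp hY

lemma aemeasurable_empMean_sample {F : Type*} [NormedAddCommGroup F] [NormedSpace ℝ F]
    [MeasurableSpace F] [BorelSpace F] [SecondCountableTopology F]
    (hX_law : ∀ i, HasLaw (X i) ν P) {Y : 𝓧 → F} (hY : AEMeasurable Y ν) (n : ℕ) :
    AEMeasurable (fun w => empMean Y (sample X n w)) P := by
  simp_rw [empMean_sample]
  exact (Finset.aemeasurable_fun_sum _ fun i _ => aemeasurable_comp_sample hX_law hY i).const_smul _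

/-- The weak law of large numbers for empirical means. -/
lemma tendstoInMeasure_empMean {F : Type*} [NormedAddCommGroup F] [NormedSpace ℝ F]
    [CompleteSpace F] [MeasurableSpace F] [BorelSpace F] [SecondCountableTopology F]
    [IsProbabilityMeasure P]
    (hX_indep : iIndepFun X P) (hX_law : ∀ i, HasLaw (X i) ν P) {Y : 𝓧 → F}
    (hY : Integrable Y ν) :
    TendstoInMeasure P (fun n w => empMean Y (sample X n w)) atTop (fun _ => ∫ x, Y x ∂ν) := by
  refine tendstoInMeasure_of_tendsto_ae
    (fun n => (aemeasurable_empMean_sample hX_law hY.aemeasurable n).aestronglyMeasurable) ?_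
  obtain ⟨Y', hY'm, hYY', hXX⟩ := exists_measurable_comp hX_law hY.aemeasurable
  have hint : Integrable Y' ν := hY.congr hYY'
  have hint0 : Integrable (fun w => Y' (X 0 w)) P := by
    have : Integrable Y' (P.map (X 0)) := by rwa [(hX_law 0).map_eq]
    exact this.comp_aemeasurable (hX_law 0).aemeasurable
  have hmean : ∫ w, Y' (X 0 w) ∂P = ∫ x, Y x ∂ν := by
    rw [integral_congr_ae hYY']
    exact (hX_law 0).integral_comp hint.aestronglyMeasurable
  have := strong_law_ae (fun i w => Y' (X i w)) hint0
    (fun i j hij => (hX_indep.comp (fun _ => Y') (fun _ => hY'm)).indepFun hij)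
    (identDistrib_comp_sample hX_law hY'm)
  filter_upwards [this, hXX] with w hw hw'
  rw [hmean] at hw
  refine hw.congr fun n => ?_
  rw [empMean_sample]
  simp [hw']

lemma withHighProb_empMean {F : Type*} [NormedAddCommGroup F] [NormedSpace ℝ F]
    [CompleteSpace F] [MeasurableSpace F] [BorelSpace F] [SecondCountableTopology F]
    [IsProbabilityMeasure P]
    (hX_indep : iIndepFun X P) (hX_law : ∀ i, HasLaw (X i) ν P) {Y : 𝓧 → F}
    (hY : Integrable Y ν) {c : F} (hc : ∫ x, Y x ∂ν = c) {ε : ℝ} (hε : 0 < ε) :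
    WithHighProb P (fun n w => ‖empMean Y (sample X n w) - c‖ < ε) := by
  have h := tendstoInMeasure_empMean hX_indep hX_law hY
  rw [tendstoInMeasure_iff_withHighProb] at h
  subst hc
  exact h ε hε

/-- The central limit theorem for standardized random vectors. -/
lemma tendstoInDistribution_stdGaussian {E : Type*} [NormedAddCommGroup E] [InnerProductSpace ℝ E]
    [FiniteDimensional ℝ E] [MeasurableSpace E] [BorelSpace E] [IsProbabilityMeasure P]
    (hX_indep : iIndepFun X P) (hX_law : ∀ i, HasLaw (X i) ν P) {Y : 𝓧 → E}
    (hY : AEMeasurable Y ν) (hmean : ∀ t, ∫ x, inner ℝ (Y x) t ∂ν = 0)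
    (hcov : ∀ t, ∫ x, inner ℝ (Y x) t ^ 2 ∂ν = ‖t‖ ^ 2) :
    TendstoInDistribution (fun (n : ℕ) w => √(n : ℝ) • empMean Y (sample X n w)) atTop (id : E → E)
      (fun _ => P) (stdGaussian E) where
  forall_aemeasurable n := (aemeasurable_empMean_sample hX_law hY n).const_smul _
  aemeasurable_limit := aemeasurable_id
  tendsto := by
    refine ProbabilityMeasure.tendsto_iff_tendsto_charFun.2 fun t => ?_
    obtain ⟨Y', hY'm, hYY', hXX⟩ := exists_measurable_comp hX_law hY
    simp only [ProbabilityMeasure.coe_mk, Measure.map_id, charFun_stdGaussian]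
    have hm : ∀ n : ℕ, AEMeasurable (fun w => √(n : ℝ) • empMean Y (sample X n w)) P := fun n =>
      (aemeasurable_empMean_sample hX_law hY n).const_smul _
    -- The projection onto t is standardized through division by ‖t‖, so t = 0 is treated apart.
    rcases eq_or_ne t 0 with rfl | ht
    · have : ∀ n : ℕ, charFun (P.map fun w => √(n : ℝ) • empMean Y (sample X n w)) 0 = 1 := by
        intro n
        have := Measure.isProbabilityMeasure_map (hm n)
        simp
      simp [this]
    have ht' : ‖t‖ ≠ 0 := norm_ne_zero_iff.2 ht
    have hmean' : ∫ x, inner ℝ (Y' x) t ∂ν = 0 := by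
      rw [← hmean t]
      exact (integral_congr_ae (hYY'.fun_comp fun y => inner ℝ y t)).symm
    have hcov' : ∫ x, inner ℝ (Y' x) t ^ 2 ∂ν = ‖t‖ ^ 2 := by
      rw [← hcov t]
      exact (integral_congr_ae (hYY'.fun_comp fun y => inner ℝ y t ^ 2)).symm
    -- Cramér–Wold: Z has mean 0 and variance 1, and the characteristic function of the vector at t
    -- is that of the normalized sum of Z at the frequency ‖t‖.
    set Z : 𝓧 → ℝ := fun x => ‖t‖⁻¹ * inner ℝ (Y' x) t with hZ
    have hZm : Measurable Z := (hY'm.inner_const (c := t)).const_mul _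
    have hZ0 : ∫ w, Z (X 0 w) ∂P = 0 := by
      rw [show ∫ w, Z (X 0 w) ∂P = ∫ x, Z x ∂ν from
        (hX_law 0).integral_comp hZm.aestronglyMeasurable]
      rw [hZ, integral_const_mul, hmean', mul_zero]
    have hZ1 : ∫ w, Z (X 0 w) ^ 2 ∂P = 1 := by
      rw [show ∫ w, Z (X 0 w) ^ 2 ∂P = ∫ x, Z x ^ 2 ∂ν from
        (hX_law 0).integral_comp (f := fun x => Z x ^ 2) (hZm.pow_const 2).aestronglyMeasurable]
      simp only [hZ, mul_pow]
      rw [integral_const_mul, hcov']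
      field_simp
    have hclt := tendstoInDistribution_inv_sqrt_mul_sum (P := P) (P' := gaussianReal 0 1)
      (X := fun i w => Z (X i w)) HasLaw.id hZ0 (by simpa using hZ1)
      (hX_indep.comp (fun _ => Z) (fun _ => hZm)) (identDistrib_comp_sample hX_law hZm)
    have h := ProbabilityMeasure.tendsto_iff_tendsto_charFun.1 hclt.tendsto ‖t‖
    simp only [ProbabilityMeasure.coe_mk, Measure.map_id, charFun_gaussianReal] at h
    convert h using 2 with n
    · rw [charFun_apply, charFun_apply, integral_map (hm n) (by fun_prop),
        integral_map (hclt.forall_aemeasurable n) (by fun_prop)]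
      refine integral_congr_ae ?_
      filter_upwards [hXX] with w hw
      have : inner ℝ (√(n : ℝ) • empMean Y (sample X n w)) t
          = inner ℝ ((√(n : ℝ))⁻¹ * ∑ k ∈ Finset.range n, Z (X k w)) ‖t‖ := by
        have e : √(n : ℝ) * (n : ℝ)⁻¹ = (√(n : ℝ))⁻¹ := by
          rcases Nat.eq_zero_or_pos n with rfl | hn
          · simp
          · have : (0 : ℝ) < n := by exact_mod_cast hn
            have h2 := Real.sqrt_pos.2 this
            field_simp
            rw [Real.sq_sqrt this.le]
        rw [empMean_sample, smul_smul, e, inner_smul_left, sum_inner]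
        simp only [hZ, ← Finset.mul_sum, hw]
        simp
        field_simp
      rw [this]
    · norm_num
      ring_nf

end LimitTheorems

/-! ### Maps close to an invertible linear map; measurable choice of roots. -/

section Deterministic

open Metric

variable {E : Type*} [NormedAddCommGroup E] [NormedSpace ℝ E]

/-- A map that is close to an invertible linear map on a ball grows at least linearly. -/
lemma norm_sub_le_of_approximatesLinear {Ψ : E → E} {A : E ≃L[ℝ] E} {N δ : ℝ}
    (hN : ‖(A.symm : E →L[ℝ] E)‖ ≤ N) (hNδ : N * δ ≤ 1 / 2) {θ θ' : E}
    (h : ‖Ψ θ - Ψ θ' - A (θ - θ')‖ ≤ δ * ‖θ - θ'‖) :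
    ‖θ - θ'‖ ≤ 2 * N * ‖Ψ θ - Ψ θ'‖ := by
  have hN0 : 0 ≤ N := (norm_nonneg _).trans hN
  have h1 : ‖θ - θ'‖ ≤ N * ‖A (θ - θ')‖ := by
    have := (A.symm : E →L[ℝ] E).le_of_opNorm_le hN (A (θ - θ'))
    simpa using this
  have h2 : ‖A (θ - θ')‖ ≤ ‖Ψ θ - Ψ θ'‖ + δ * ‖θ - θ'‖ := by
    have := norm_sub_norm_le (A (θ - θ')) (Ψ θ - Ψ θ')
    rw [norm_sub_rev (A (θ - θ'))] at this
    linarith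
  -- Since N δ ≤ 1/2, the error is absorbed into the left side at the cost of a factor 2.
  have h3 := mul_le_mul_of_nonneg_left h2 hN0
  have h4 := mul_le_mul_of_nonneg_right hNδ (norm_nonneg (θ - θ'))
  nlinarith

/-- A map that is close to an invertible linear map on a ball and small at its centre has a root
in the ball. -/
lemma exists_root_of_approximatesLinear [CompleteSpace E] {Ψ : E → E} {A : E ≃L[ℝ] E} {N δ ρ : ℝ}
    (hN : ‖(A.symm : E →L[ℝ] E)‖ ≤ N) (hN0 : 0 < N) (hδ : 0 ≤ δ) (hNδ : N * δ ≤ 1 / 2) (hρ : 0 ≤ ρ)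
    {θ₀ : E}
    (h : ∀ θ ∈ closedBall θ₀ ρ, ∀ θ' ∈ closedBall θ₀ ρ,
      ‖Ψ θ - Ψ θ' - A (θ - θ')‖ ≤ δ * ‖θ - θ'‖)
    (h0 : 2 * N * ‖Ψ θ₀‖ ≤ ρ) : ∃ θ ∈ closedBall θ₀ ρ, Ψ θ = 0 := by
  have happ : ApproximatesLinearOn Ψ (A : E →L[ℝ] E) (closedBall θ₀ ρ) ⟨δ, hδ⟩ := by
    intro x hx y hy
    exact h x hx y hy
  let inv : (A : E →L[ℝ] E).NonlinearRightInverse :=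
    { toFun := A.symm
      nnnorm := ⟨N, hN0.le⟩
      bound' := fun y => (A.symm : E →L[ℝ] E).le_of_opNorm_le hN y
      right_inv' := fun y => A.apply_symm_apply y }
  -- The image of the ball contains the ball of radius (N⁻¹ - δ) ρ about Ψ θ₀; as N⁻¹ - δ ≥ 1/(2N),
  -- it contains 0.
  have hs := happ.surjOn_closedBall_of_nonlinearRightInverse inv hρ subset_rfl
  have h0' : (0 : E) ∈ closedBall (Ψ θ₀) (((inv.nnnorm : ℝ)⁻¹ - (⟨δ, hδ⟩ : NNReal)) * ρ) := by
    rw [mem_closedBall, dist_eq_norm, zero_sub, norm_neg]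
    change ‖Ψ θ₀‖ ≤ (N⁻¹ - δ) * ρ
    have h1 : (2 * N)⁻¹ ≤ N⁻¹ - δ := by
      have : N⁻¹ - δ - (2 * N)⁻¹ = (1 / 2 - N * δ) / N := by field_simp; ring
      have h2 : 0 ≤ (1 / 2 - N * δ) / N := div_nonneg (by linarith) hN0.le
      linarith
    calc ‖Ψ θ₀‖ = (2 * N)⁻¹ * (2 * N * ‖Ψ θ₀‖) := by field_simp
      _ ≤ (2 * N)⁻¹ * ρ := by gcongr
      _ ≤ _ := by gcongr
  obtain ⟨θ, hθ, hθ0⟩ := hs h0'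
  exact ⟨θ, hθ, hθ0⟩

end Deterministic

/-- Measurable selection of a well-separated root: if `q k s` measures the defect at `D k` of an
equation with parameter `s`, and the defect controls the distance to `θ`, then `θ` is found
measurably. -/
lemma exists_measurable_limit_of_defect {S E : Type*} [MeasurableSpace S] [NormedAddCommGroup E]
    [CompleteSpace E] [SecondCountableTopology E] [MeasurableSpace E] [BorelSpace E]
    (D : ℕ → E) (q : ℕ → S → ℝ) (hq : ∀ k, Measurable (q k)) :
    ∃ T : S → E, Measurable T ∧ ∀ s θ C, 0 ≤ C → (∀ k, ‖D k - θ‖ ≤ C * q k s) →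
      (∀ ε > 0, ∃ k, q k s < ε) → T s = θ := by
  classical
  -- The second alternative only makes the search total: it applies where no `D k` has a small
  -- defect.
  let good : ℕ → S → ℕ → Prop := fun m s k =>
    q k s < 1 / ((m : ℝ) + 1) ∨ ∀ j, ¬ q j s < 1 / ((m : ℝ) + 1)
  have hgood : ∀ m s, ∃ k, good m s k := by
    intro m s
    by_cases h : ∃ k, q k s < 1 / ((m : ℝ) + 1)
    · obtain ⟨k, hk⟩ := h
      exact ⟨k, Or.inl hk⟩
    · exact ⟨0, Or.inr (not_exists.1 h)⟩
  have hset : ∀ m k, MeasurableSet {s | q k s < 1 / ((m : ℝ) + 1)} := fun m k =>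
    measurableSet_lt (hq k) measurable_const
  have hmeas : ∀ m, Measurable fun s => D (Nat.find (hgood m s)) := by
    intro m
    refine (measurable_from_top (f := D)).comp (measurable_find (hgood m) fun k => ?_)
    have : {s | good m s k} = {s | q k s < 1 / ((m : ℝ) + 1)} ∪
        ⋂ j, {s | q j s < 1 / ((m : ℝ) + 1)}ᶜ := by
      ext s
      simp [good]
    exact this ▸ (hset m k).union (MeasurableSet.iInter fun j => (hset m j).compl)
  -- `limUnder` is measurable in s whether or not the sequence converges.
  refine ⟨fun s => limUnder atTop fun m => D (Nat.find (hgood m s)),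
    (StronglyMeasurable.limUnder fun m => (hmeas m).stronglyMeasurable).measurable, ?_⟩
  intro s θ C hC hdist hsmall
  refine Tendsto.limUnder_eq ?_
  rw [tendsto_iff_norm_sub_tendsto_zero]
  have hlim : Tendsto (fun m : ℕ => C * (1 / ((m : ℝ) + 1))) atTop (𝓝 0) := by
    simpa using tendsto_one_div_add_atTop_nhds_zero_nat.const_mul C
  refine squeeze_zero (fun _ => norm_nonneg _) (fun m => ?_) hlim
  refine (hdist _).trans (mul_le_mul_of_nonneg_left ?_ hC)
  rcases Nat.find_spec (hgood m s) with h | h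
  · exact h.le
  · obtain ⟨k, hk⟩ := hsmall (1 / ((m : ℝ) + 1)) (by positivity)
    exact absurd hk (h k)

/-- A remainder that is negligible relative to a sequence converging in distribution converges to
zero in probability. -/
lemma tendstoInMeasure_zero_of_relatively_small {Ω Ω' F G : Type*} [MeasurableSpace Ω]
    [MeasurableSpace Ω'] {P : Measure Ω} [IsProbabilityMeasure P] {P' : Measure Ω'}
    [IsProbabilityMeasure P'] [NormedAddCommGroup F] [MeasurableSpace F] [BorelSpace F]
    [NormedAddCommGroup G] {S : ℕ → Ω → F} {Z : Ω' → F} {R : ℕ → Ω → G}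
    (hS : TendstoInDistribution S atTop Z (fun _ => P) P')
    (hR : ∀ δ > 0, WithHighProb P (fun n w => ‖R n w‖ ≤ δ * ‖S n w‖)) :
    TendstoInMeasure P R atTop 0 := by
  rw [tendstoInMeasure_iff_withHighProb]
  intro ε hε
  rw [WithHighProb, ENNReal.tendsto_nhds_zero]
  intro η hη
  have hη2 : 0 < η / 2 := ENNReal.half_pos hη.ne'
  -- Tightness of the limit law: beyond some k it has mass below η / 2, and the portmanteau theorem
  -- carries this over to `S n`.
  have htail : Tendsto (fun k : ℕ => (P'.map Z) {y | (k : ℝ) ≤ ‖y‖}) atTop (𝓝 0) := by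
    have hprob := Measure.isProbabilityMeasure_map hS.aemeasurable_limit
    have := tendsto_measure_iInter_atTop (μ := P'.map Z) (s := fun k : ℕ => {y : F | (k : ℝ) ≤ ‖y‖})
      (fun k => (isClosed_le continuous_const continuous_norm).measurableSet.nullMeasurableSet)
      (fun i j hij y hy => (Nat.cast_le (α := ℝ).2 hij).trans (show (j : ℝ) ≤ ‖y‖ from hy)) ⟨0, measure_ne_top _ _⟩
    have hempty : (⋂ k : ℕ, {y : F | (k : ℝ) ≤ ‖y‖}) = ∅ := by
      ext y
      obtain ⟨k, hk⟩ := exists_nat_gt ‖y‖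
      simp only [Set.mem_iInter, Set.mem_ofPred_eq, Set.mem_empty_iff_false, iff_false, not_forall,
        not_le]
      exact ⟨k, hk⟩
    rwa [hempty, measure_empty] at this
  obtain ⟨k, hk⟩ := (htail.eventually (gt_mem_nhds hη2)).exists
  have hclosed : IsClosed {y : F | (k : ℝ) ≤ ‖y‖} := isClosed_le continuous_const continuous_norm
  have hlimsup := ProbabilityMeasure.limsup_measure_closed_le_of_tendsto hS.tendsto hclosed
  have hev := eventually_lt_of_limsup_lt (hlimsup.trans_lt hk)
  -- For ‖S n‖ < k this ratio gives ‖R n‖ ≤ ε k / (k + 1) < ε.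
  have hδ : 0 < ε / ((k : ℝ) + 1) := by positivity
  have hev2 := (hR _ hδ).eventually (gt_mem_nhds hη2)
  filter_upwards [hev, hev2] with n hn1 hn2
  simp only [ProbabilityMeasure.coe_mk] at hn1
  rw [Measure.map_apply_of_aemeasurable (hS.forall_aemeasurable n) hclosed.measurableSet] at hn1
  calc P {w | ¬ ‖R n w - (0 : Ω → G) w‖ < ε}
      ≤ P (S n ⁻¹' {y | (k : ℝ) ≤ ‖y‖} ∪ {w | ¬ ‖R n w‖ ≤ ε / ((k : ℝ) + 1) * ‖S n w‖}) := by
        refine measure_mono fun w hw => ?_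
        by_contra hcon
        simp only [Set.mem_union, Set.mem_preimage, Set.mem_ofPred_eq, not_or, not_le] at hcon
        refine hw ?_
        rw [Pi.zero_apply, sub_zero]
        refine (not_lt.1 hcon.2).trans_lt ?_
        calc ε / ((k : ℝ) + 1) * ‖S n w‖ ≤ ε / ((k : ℝ) + 1) * k := by
              gcongr
              exact hcon.1.le
          _ < ε / ((k : ℝ) + 1) * (k + 1) := by
              gcongr
              linarith
          _ = ε := by field_simp
    _ ≤ _ := measure_union_le _ _
    _ ≤ η / 2 + η / 2 := add_le_add hn1.le hn2.le
    _ = η := ENNReal.add_halves η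

/-! ### Roots of regular estimating equations: existence and asymptotic law. -/

section Estimation

open Metric

/-- The linear expansion of empirical means of estimating functions. -/
lemma norm_empMean_sub_sub_le {𝓧 E : Type*} [NormedAddCommGroup E] [NormedSpace ℝ E]
    {ψ : E → 𝓧 → E} {H : 𝓧 → E →L[ℝ] E} {M : 𝓧 → ℝ} {θ θ' : E} {c : ℝ} {n : ℕ}
    (x : Fin n → 𝓧) (h : ∀ i, ‖ψ θ (x i) - ψ θ' (x i) - H (x i) (θ - θ')‖ ≤ M (x i) * c) :
    ‖empMean (ψ θ) x - empMean (ψ θ') x - empMean H x (θ - θ')‖ ≤ empMean M x * c := by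
  have e : empMean (ψ θ) x - empMean (ψ θ') x - empMean H x (θ - θ') = (n : ℝ)⁻¹ • ∑ i : Fin n,
        (ψ θ (x i) - ψ θ' (x i) - H (x i) (θ - θ')) := by
    simp only [empMean, Finset.sum_sub_distrib, smul_sub, _root_.smul_apply,
      _root_.sum_apply, map_sub]
  rw [e, norm_smul, empMean, norm_inv, RCLike.norm_natCast, smul_eq_mul, mul_assoc,
    Finset.sum_mul]
  gcongr
  exact (norm_sum_le _ _).trans (Finset.sum_le_sum fun i _ => h i)

variable {𝓧 Ω E : Type*} [MeasurableSpace 𝓧] [MeasurableSpace Ω]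
  [NormedAddCommGroup E] [InnerProductSpace ℝ E] [FiniteDimensional ℝ E]
  [MeasurableSpace E]

/-- Regularity of a family `ψ` of estimating functions near `θ₀`: at `θ₀` the mean is `0` and the
mean derivative is `A`, and the family is approximated by its derivative at `θ₀` up to an error of
second order with an integrable constant. -/
structure RegularEstimatingFamily (ψ : E → 𝓧 → E) (ν : Measure 𝓧) (θ₀ : E) (r : ℝ)
    (A : E ≃L[ℝ] E) : Prop where
  radius_pos : 0 < r
  aemeasurable : ∀ θ ∈ closedBall θ₀ r, AEMeasurable (ψ θ) ν
  integrable : Integrable (ψ θ₀) ν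
  mean : ∫ x, ψ θ₀ x ∂ν = 0
  expansion : ∃ (H : 𝓧 → E →L[ℝ] E) (M : 𝓧 → ℝ), Integrable H ν ∧ ∫ x, H x ∂ν = A ∧
    Integrable M ν ∧ ∀ᵐ x ∂ν, ∀ ρ ≤ r, ∀ θ ∈ closedBall θ₀ ρ, ∀ θ' ∈ closedBall θ₀ ρ,
      ‖ψ θ x - ψ θ' x - H x (θ - θ')‖ ≤ M x * ρ * ‖θ - θ'‖

variable {P : Measure Ω} [IsProbabilityMeasure P] {ν : Measure 𝓧} {X : ℕ → Ω → 𝓧}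
  {ψ : E → 𝓧 → E} {θ₀ : E} {r : ℝ} {A : E ≃L[ℝ] E}

/-- Half of δ pays for replacing the empirical mean of `H` by `A`, uniformly because `H` does not
depend on θ. The other half pays for the second-order error: the empirical mean of `M` is at most
|m| + 1, and ρ is chosen against that number. Arbitrary pairs of points, not just pairs with θ₀, are
needed for uniqueness and surjectivity. -/
lemma RegularEstimatingFamily.approximatesLinear (hψ : RegularEstimatingFamily ψ ν θ₀ r A)
    (hX_indep : iIndepFun X P) (hX_law : ∀ i, HasLaw (X i) ν P) {δ : ℝ} (hδ : 0 < δ) :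
    ∃ ρ, 0 < ρ ∧ ρ ≤ r ∧ WithHighProb P (fun n w => ∀ θ ∈ closedBall θ₀ ρ, ∀ θ' ∈ closedBall θ₀ ρ,
      ‖empMean (ψ θ) (sample X n w) - empMean (ψ θ') (sample X n w) - A (θ - θ')‖
        ≤ δ * ‖θ - θ'‖) := by
  obtain ⟨H, M, hH, hHA, hM, hexp⟩ := hψ.expansion
  set m := ∫ x, M x ∂ν with hm
  have hm1 : 0 < |m| + 1 := by positivity
  refine ⟨min r (δ / 2 / (|m| + 1)), lt_min hψ.radius_pos (by positivity), min_le_left _ _, ?_⟩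
  set ρ := min r (δ / 2 / (|m| + 1)) with hρ
  have hρ0 : 0 ≤ ρ := le_min hψ.radius_pos.le (by positivity)
  have hρδ : (|m| + 1) * ρ ≤ δ / 2 := by
    have := min_le_right r (δ / 2 / (|m| + 1))
    rw [le_div_iff₀ hm1] at this
    linarith
  have hHlln := withHighProb_empMean hX_indep hX_law hH hHA (half_pos hδ)
  have hMlln := withHighProb_empMean hX_indep hX_law hM hm.symm one_pos
  refine (hHlln.and hMlln).mono_ae (Eventually.of_forall fun n => ?_)
  filter_upwards [ae_forall_sample hX_law hexp] with w hw
  rintro ⟨h1, h2⟩ θ hθ θ' hθ'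
  have key := norm_empMean_sub_sub_le (ψ := ψ) (H := H) (M := M) (c := ρ * ‖θ - θ'‖)
    (sample X n w) fun i => by
      rw [← mul_assoc]
      exact hw i ρ (min_le_left _ _) θ hθ θ' hθ'
  rw [← mul_assoc] at key
  have h3 : ‖empMean H (sample X n w) (θ - θ') - A (θ - θ')‖ ≤ δ / 2 * ‖θ - θ'‖ :=
    (empMean H (sample X n w) - (A : E →L[ℝ] E)).le_of_opNorm_le h1.le (θ - θ')
  have h4 : empMean M (sample X n w) ≤ |m| + 1 := by
    rw [Real.norm_eq_abs, abs_lt] at h2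
    linarith [le_abs_self m]
  have h5 : empMean M (sample X n w) * ρ * ‖θ - θ'‖ ≤ δ / 2 * ‖θ - θ'‖ := by
    gcongr
    exact (mul_le_mul_of_nonneg_right h4 hρ0).trans hρδ
  have h6 := norm_sub_le_norm_sub_add_norm_sub
    (empMean (ψ θ) (sample X n w) - empMean (ψ θ') (sample X n w))
    (empMean H (sample X n w) (θ - θ')) (A (θ - θ'))
  linarith

variable [BorelSpace E]

/-- Existence of a consistent sequence of measurable roots of the estimating equation. -/
theorem RegularEstimatingFamily.exists_consistent_roots (hψ : RegularEstimatingFamily ψ ν θ₀ r A)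
    (hX_indep : iIndepFun X P) (hX_law : ∀ i, HasLaw (X i) ν P) :
    ∃ T : (n : ℕ) → (Fin n → 𝓧) → E, (∀ n, Measurable (T n)) ∧
      WithHighProb P (fun n w => T n (sample X n w) ∈ closedBall θ₀ r ∧
        empMean (ψ (T n (sample X n w))) (sample X n w) = 0) ∧
      TendstoInMeasure P (fun n w => T n (sample X n w)) atTop (fun _ => θ₀) := by
  set N : ℝ := ‖(A.symm : E →L[ℝ] E)‖ + 1 with hN
  have hN0 : 0 < N := by positivity
  have hNA : ‖(A.symm : E →L[ℝ] E)‖ ≤ N := by linarith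
  obtain ⟨ρ, hρ0, hρr, happ⟩ := hψ.approximatesLinear hX_indep hX_law
    (δ := 1 / (2 * N)) (by positivity)
  have hNδ : N * (1 / (2 * N)) ≤ 1 / 2 := by
    apply le_of_eq
    field_simp
  have hne : Nonempty (closedBall θ₀ ρ) := ⟨⟨θ₀, mem_closedBall_self hρ0.le⟩⟩
  let D : ℕ → closedBall θ₀ ρ := TopologicalSpace.denseSeq (closedBall θ₀ ρ)
  have hDr : ∀ k, (D k : E) ∈ closedBall θ₀ r := fun k => closedBall_subset_closedBall hρr (D k).2
  -- Only the countably many parameters `D k` enter the search, so one null set covers all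
  -- replacements by measurable versions.
  choose ψ' hψ'm _ hψ'X using fun k => exists_measurable_comp hX_law (hψ.aemeasurable _ (hDr k))
  have hqm : ∀ n k, Measurable fun x : Fin n → 𝓧 => ‖empMean (ψ' k) x‖ := by
    intro n k
    refine Measurable.norm (Measurable.const_smul ?_ _)
    exact Finset.measurable_sum _ fun i _ => (hψ'm k).comp (measurable_pi_apply i)
  choose T hTm hT using fun n => exists_measurable_limit_of_defect (fun k => (D k : E))
    (fun k (x : Fin n → 𝓧) => ‖empMean (ψ' k) x‖) (hqm n)
  -- The last clause yields consistency, since the empirical mean at θ₀ tends to 0 in probability.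
  have hroot : WithHighProb P (fun n w => T n (sample X n w) ∈ closedBall θ₀ ρ ∧
      empMean (ψ (T n (sample X n w))) (sample X n w) = 0 ∧
      ‖T n (sample X n w) - θ₀‖ ≤ 2 * N * ‖empMean (ψ θ₀) (sample X n w)‖) := by
    have h0 := withHighProb_empMean hX_indep hX_law hψ.integrable hψ.mean
      (ε := ρ / (2 * N)) (by positivity)
    refine (happ.and h0).mono_ae (Eventually.of_forall fun n => ?_)
    filter_upwards [ae_all_iff.2 hψ'X] with w hw
    rintro ⟨h1, h2⟩
    rw [sub_zero, lt_div_iff₀ (by positivity)] at h2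
    obtain ⟨θ, hθ, hθ0⟩ := exists_root_of_approximatesLinear
      (Ψ := fun θ => empMean (ψ θ) (sample X n w)) hNA hN0 (by positivity) hNδ hρ0.le h1
      (by linarith)
    have hbound : ∀ θ' ∈ closedBall θ₀ ρ,
        ‖θ' - θ‖ ≤ 2 * N * ‖empMean (ψ θ') (sample X n w)‖ := by
      intro θ' hθ'
      have := norm_sub_le_of_approximatesLinear
        (Ψ := fun θ => empMean (ψ θ) (sample X n w)) hNA hNδ (h1 θ' hθ' θ hθ)
      simpa [hθ0] using this
    have hq : ∀ k, empMean (ψ' k) (sample X n w) = empMean (ψ (D k)) (sample X n w) := by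
      intro k
      rw [empMean_sample, empMean_sample]
      simp [hw k]
    have hTθ : T n (sample X n w) = θ := by
      refine hT n _ θ (2 * N) (by positivity) (fun k => ?_) fun ε hε => ?_
      · rw [hq]
        exact hbound _ (D k).2
      -- Near the root the defect is small: the empirical mean is Lipschitz on the ball with
      -- constant ‖A‖ + 1/(2N).
      · have hA0 : 0 < ‖(A : E →L[ℝ] E)‖ + 1 / (2 * N) := by positivity
        obtain ⟨k, hk⟩ := (TopologicalSpace.denseRange_denseSeq (closedBall θ₀ ρ)).exists_dist_lt
          ⟨θ, hθ⟩ (show 0 < ε / (‖(A : E →L[ℝ] E)‖ + 1 / (2 * N)) by positivity)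
        refine ⟨k, ?_⟩
        rw [hq]
        rw [Subtype.dist_eq, dist_comm, dist_eq_norm, lt_div_iff₀ hA0] at hk
        have h3 := h1 (D k) (D k).2 θ hθ
        rw [hθ0, sub_zero] at h3
        have h4 := (A : E →L[ℝ] E).le_opNorm (D k - θ)
        have h5 := norm_sub_norm_le (empMean (ψ (D k)) (sample X n w)) (A (D k - θ))
        rw [ContinuousLinearEquiv.coe_coe] at h4
        have h6 : ‖(D k : E) - θ‖ * (‖(A : E →L[ℝ] E)‖ + 1 / (2 * N)) < ε := hk
        linarith
    rw [hTθ]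
    refine ⟨hθ, hθ0, ?_⟩
    rw [norm_sub_rev]
    exact hbound θ₀ (mem_closedBall_self hρ0.le)
  refine ⟨T, hTm, hroot.mono fun n w h => ⟨closedBall_subset_closedBall hρr h.1, h.2.1⟩, ?_⟩
  rw [tendstoInMeasure_iff_withHighProb]
  intro ε hε
  have h0 := withHighProb_empMean hX_indep hX_law hψ.integrable hψ.mean
    (ε := ε / (2 * N)) (by positivity)
  refine (hroot.and h0).mono fun n w h => ?_
  have h2 := h.2
  rw [sub_zero, lt_div_iff₀ (by positivity)] at h2
  linarith [h.1.2.2]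

/-- Asymptotic distribution of a consistent sequence of roots, for a standardized estimating
function. -/
theorem RegularEstimatingFamily.tendstoInDistribution_roots
    (hψ : RegularEstimatingFamily ψ ν θ₀ r A)
    (hX_indep : iIndepFun X P) (hX_law : ∀ i, HasLaw (X i) ν P)
    (hcov : ∀ t, ∫ x, inner ℝ (ψ θ₀ x) t ^ 2 ∂ν = ‖t‖ ^ 2)
    {T : (n : ℕ) → (Fin n → 𝓧) → E} (hT : ∀ n, Measurable (T n))
    (hroot : WithHighProb P (fun n w => empMean (ψ (T n (sample X n w))) (sample X n w) = 0))
    (hcons : TendstoInMeasure P (fun n w => T n (sample X n w)) atTop (fun _ => θ₀)) :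
    TendstoInDistribution (fun (n : ℕ) w => -(√(n : ℝ) • A (T n (sample X n w) - θ₀))) atTop
      (id : E → E) (fun _ => P) (stdGaussian E) := by
  have hclt := tendstoInDistribution_stdGaussian hX_indep hX_law
    (hψ.aemeasurable θ₀ (mem_closedBall_self hψ.radius_pos.le))
    (fun t => by
      simp_rw [real_inner_comm t]
      rw [integral_inner hψ.integrable, hψ.mean, inner_zero_right]) hcov
  -- Slutsky: the difference from the normalized mean at θ₀ is shown to be small relative to that
  -- mean, which converges in distribution.
  refine tendstoInDistribution_of_tendstoInMeasure_sub _ _ hclt ?_ fun n => ?_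
  · refine tendstoInMeasure_zero_of_relatively_small hclt fun δ hδ => ?_
    set N : ℝ := ‖(A.symm : E →L[ℝ] E)‖ + 1 with hN
    have hN0 : 0 < N := by positivity
    have hNA : ‖(A.symm : E →L[ℝ] E)‖ ≤ N := by linarith
    obtain ⟨ρ, hρ0, hρr, happ⟩ := hψ.approximatesLinear hX_indep hX_law
      -- The first bound permits absorption; the second turns ‖t - θ₀‖ ≤ 2N ‖mean at θ₀‖ into a
      -- remainder of relative size δ.
      (δ := min (1 / (2 * N)) (δ / (2 * N))) (by positivity)
    have hNδ : N * min (1 / (2 * N)) (δ / (2 * N)) ≤ 1 / 2 := by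
      calc _ ≤ N * (1 / (2 * N)) := by
            gcongr
            exact min_le_left _ _
        _ = 1 / 2 := by field_simp
    refine ((happ.and hroot).and (tendstoInMeasure_iff_withHighProb.1 hcons ρ hρ0)).mono ?_
    rintro n w ⟨⟨h1, h2⟩, h3⟩
    set t := T n (sample X n w)
    have ht : t ∈ closedBall θ₀ ρ := by
      rw [mem_closedBall, dist_eq_norm]
      exact h3.le
    have h4 := h1 t ht θ₀ (mem_closedBall_self hρ0.le)
    have h5 := norm_sub_le_of_approximatesLinear
        (Ψ := fun θ => empMean (ψ θ) (sample X n w)) hNA hNδ h4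
    simp only [h2, zero_sub, norm_neg] at h4 h5
    have e : -(√(n : ℝ) • A (T n (sample X n w) - θ₀))
        - √(n : ℝ) • empMean (ψ θ₀) (sample X n w)
        = √(n : ℝ) • (-empMean (ψ θ₀) (sample X n w) - A (t - θ₀)) := by
      simp only [t, smul_sub, smul_neg]
      abel
    change ‖-(√(n : ℝ) • A (T n (sample X n w) - θ₀))
        - √(n : ℝ) • empMean (ψ θ₀) (sample X n w)‖ ≤ _
    rw [e, norm_smul, norm_smul]
    have h6 : ‖-empMean (ψ θ₀) (sample X n w) - A (t - θ₀)‖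
        ≤ δ * ‖empMean (ψ θ₀) (sample X n w)‖ := by
      calc _ ≤ min (1 / (2 * N)) (δ / (2 * N)) * ‖t - θ₀‖ := h4
        _ ≤ δ / (2 * N) * (2 * N * ‖empMean (ψ θ₀) (sample X n w)‖) := by
            gcongr
            exact min_le_right _ _
        _ = _ := by field_simp
    calc _ ≤ ‖√(n : ℝ)‖ * (δ * ‖empMean (ψ θ₀) (sample X n w)‖) := by gcongr
      _ = _ := by ring
  · have hs : AEMeasurable (sample X n) P :=
      aemeasurable_pi_iff.2 fun i => (hX_law i).aemeasurable
    have := (hT n).comp_aemeasurable hs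
    have h1 : Measurable fun t : E => -(√(n : ℝ) • A (t - θ₀)) :=
      (by fun_prop : Continuous fun t : E => -(√(n : ℝ) • A (t - θ₀))).measurable
    exact h1.comp_aemeasurable this

end Estimation

/-! ### Third derivatives and linear expansion of the gradient. -/

section Calculus

open Metric

variable {E F : Type*} [NormedAddCommGroup E] [NormedSpace ℝ E] [NormedAddCommGroup F]
  [NormedSpace ℝ F]

/-- Translates between iterated derivatives, in which the hypotheses are stated, and nested
`fderiv`, in which the expansions are done. -/
lemma exists_isometry_iteratedFDeriv_one (E F : Type*) [NormedAddCommGroup E] [NormedSpace ℝ E]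
    [NormedAddCommGroup F] [NormedSpace ℝ F] :
    ∃ e : (E →L[ℝ] F) ≃ₗᵢ[ℝ] (ContinuousMultilinearMap ℝ (fun _ : Fin 1 => E) F),
      ∀ (g : E → F) θ, iteratedFDeriv ℝ 1 g θ = e (fderiv ℝ g θ) := by
  refine ⟨((continuousMultilinearCurryRightEquiv' ℝ 0 E F).trans
    (continuousMultilinearCurryFin0 ℝ E (E →L[ℝ] F))).symm, fun g θ => ?_⟩
  rw [iteratedFDeriv_succ_eq_comp_right]
  rfl

lemma exists_isometry_iteratedFDeriv_two (E F : Type*) [NormedAddCommGroup E] [NormedSpace ℝ E]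
    [NormedAddCommGroup F] [NormedSpace ℝ F] :
    ∃ e : (E →L[ℝ] E →L[ℝ] F) ≃ₗᵢ[ℝ] (ContinuousMultilinearMap ℝ (fun _ : Fin 2 => E) F),
      ∀ (g : E → F) θ, iteratedFDeriv ℝ 2 g θ = e (fderiv ℝ (fderiv ℝ g) θ) := by
  obtain ⟨e₁, he₁⟩ := exists_isometry_iteratedFDeriv_one E (E →L[ℝ] F)
  refine ⟨e₁.trans (continuousMultilinearCurryRightEquiv' ℝ 1 E F).symm, fun g θ => ?_⟩
  rw [iteratedFDeriv_succ_eq_comp_right]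
  simp only [Function.comp_apply, LinearIsometryEquiv.trans_apply]
  congr 1
  exact he₁ _ _

/-- `V` is three times differentiable at each point of `ω`. -/
def ThriceDifferentiableOn (V : E → F) (ω : Set E) : Prop :=
  ∀ θ ∈ ω, DifferentiableAt ℝ V θ ∧ DifferentiableAt ℝ (fderiv ℝ V) θ ∧
    DifferentiableAt ℝ (fderiv ℝ (fderiv ℝ V)) θ

lemma ThriceDifferentiableOn.of_contDiffOn {V : E → F} {ω : Set E} (hω : IsOpen ω)
    (hV : ContDiffOn ℝ 3 V ω) : ThriceDifferentiableOn V ω := by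
  intro θ hθ
  have h := hV.contDiffAt (hω.mem_nhds hθ)
  have h1 : ContDiffAt ℝ 2 (fderiv ℝ V) θ := h.fderiv_right (by norm_num)
  have h2 : ContDiffAt ℝ 1 (fderiv ℝ (fderiv ℝ V)) θ := h1.fderiv_right (by norm_num)
  exact ⟨h.differentiableAt (by norm_num), h1.differentiableAt (by norm_num),
    h2.differentiableAt (by norm_num)⟩

lemma fderiv_eventuallyEq_of_eqOn {V W : E → F} {ω : Set E} (hω : IsOpen ω) (h : Set.EqOn V W ω) :
    Set.EqOn (fderiv ℝ V) (fderiv ℝ W) ω := fun _ hθ =>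
  (h.eventuallyEq_of_mem (hω.mem_nhds hθ)).fderiv_eq

lemma ThriceDifferentiableOn.congr {V W : E → F} {ω : Set E} (hω : IsOpen ω)
    (hV : ThriceDifferentiableOn V ω) (h : Set.EqOn W V ω) : ThriceDifferentiableOn W ω := by
  intro θ hθ
  have h1 := fderiv_eventuallyEq_of_eqOn hω h
  have h2 := fderiv_eventuallyEq_of_eqOn hω h1
  have hn := hω.mem_nhds hθ
  obtain ⟨a, b, c⟩ := hV θ hθ
  exact ⟨a.congr_of_eventuallyEq (h.eventuallyEq_of_mem hn),
    b.congr_of_eventuallyEq (h1.eventuallyEq_of_mem hn),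
    c.congr_of_eventuallyEq (h2.eventuallyEq_of_mem hn)⟩

lemma ThriceDifferentiableOn.fderiv_sub {V W : E → F} {ω : Set E}
    (hV : ThriceDifferentiableOn V ω) (hW : ThriceDifferentiableOn W ω) :
    Set.EqOn (fderiv ℝ (V - W)) (fderiv ℝ V - fderiv ℝ W) ω := fun θ hθ =>
  _root_.fderiv_sub (hV θ hθ).1 (hW θ hθ).1

lemma ThriceDifferentiableOn.fderiv_fderiv_sub {V W : E → F} {ω : Set E} (hω : IsOpen ω)
    (hV : ThriceDifferentiableOn V ω) (hW : ThriceDifferentiableOn W ω) :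
    Set.EqOn (fderiv ℝ (fderiv ℝ (V - W)))
      (fderiv ℝ (fderiv ℝ V) - fderiv ℝ (fderiv ℝ W)) ω := fun θ hθ => by
  rw [fderiv_eventuallyEq_of_eqOn hω (hV.fderiv_sub hW) hθ]
  exact _root_.fderiv_sub (hV θ hθ).2.1 (hW θ hθ).2.1

lemma ThriceDifferentiableOn.sub {V W : E → F} {ω : Set E} (hω : IsOpen ω)
    (hV : ThriceDifferentiableOn V ω) (hW : ThriceDifferentiableOn W ω) :
    ThriceDifferentiableOn (V - W) ω := by
  intro θ hθ
  have hn := hω.mem_nhds hθ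
  exact ⟨(hV θ hθ).1.sub (hW θ hθ).1,
    ((hV θ hθ).2.1.sub (hW θ hθ).2.1).congr_of_eventuallyEq
      ((hV.fderiv_sub hW).eventuallyEq_of_mem hn),
    ((hV θ hθ).2.2.sub (hW θ hθ).2.2).congr_of_eventuallyEq
      ((hV.fderiv_fderiv_sub hω hW).eventuallyEq_of_mem hn)⟩

/-- A bound for the third derivative controls the error of the linear expansion of the gradient. -/
lemma ThriceDifferentiableOn.norm_fderiv_sub_sub_le {V : E → F} {ω : Set E}
    (hV : ThriceDifferentiableOn V ω) {M : ℝ} (hM : ∀ θ ∈ ω, ‖iteratedFDeriv ℝ 3 V θ‖ ≤ M)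
    {θ₀ : E} {ρ : ℝ} (hρ : closedBall θ₀ ρ ⊆ ω) {θ θ' : E} (hθ : θ ∈ closedBall θ₀ ρ)
    (hθ' : θ' ∈ closedBall θ₀ ρ) :
    ‖fderiv ℝ V θ - fderiv ℝ V θ' - fderiv ℝ (fderiv ℝ V) θ₀ (θ - θ')‖ ≤ M * ρ * ‖θ - θ'‖ := by
  have hρ0 : 0 ≤ ρ := dist_nonneg.trans hθ
  have h0 : θ₀ ∈ closedBall θ₀ ρ := mem_closedBall_self hρ0
  have hM0 : 0 ≤ M := (norm_nonneg _).trans (hM θ₀ (hρ h0))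
  have h3 : ∀ t ∈ closedBall θ₀ ρ, ‖fderiv ℝ (fderiv ℝ (fderiv ℝ V)) t‖ ≤ M := by
    intro t ht
    rw [← norm_iteratedFDeriv_one, norm_iteratedFDeriv_fderiv, norm_iteratedFDeriv_fderiv]
    exact hM t (hρ ht)
  -- The mean value inequality is used twice: for the second derivative here, then for the gradient
  -- minus its linearization at the centre.
  have h2 : ∀ t ∈ closedBall θ₀ ρ,
      ‖fderiv ℝ (fderiv ℝ V) t - fderiv ℝ (fderiv ℝ V) θ₀‖ ≤ M * ρ := by
    intro t ht
    refine ((convex_closedBall θ₀ ρ).norm_image_sub_le_of_norm_fderiv_le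
      (fun s hs => (hV s (hρ hs)).2.2) h3 h0 ht).trans ?_
    rw [mem_closedBall, dist_eq_norm] at ht
    gcongr
  exact (convex_closedBall θ₀ ρ).norm_image_sub_le_of_norm_fderiv_le'
    (fun s hs => (hV s (hρ hs)).2.1) h2 hθ' hθ

end Calculus

/-! ### Derivatives under the integral sign. -/

section UnderIntegral

variable {p : ℕ} {𝓧 : Type*} [MeasurableSpace 𝓧] {μ : Measure 𝓧}
  {F : EuclideanSpace ℝ (Fin p) → 𝓧 → ℝ} {ω : Set (EuclideanSpace ℝ (Fin p))}

/-- The hypothesis differentiates one order at a time; an equality on the open set ω may be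
differentiated, and the currying isometries commute with the integral. -/
lemma DiffThriceUnderIntegral.iteratedFDeriv_integral (hF : DiffThriceUnderIntegral F μ ω)
    (hω : IsOpen ω) (k : ℕ) (hk : k ≤ 3) :
    Set.EqOn (iteratedFDeriv ℝ k fun t => ∫ x, F t x ∂μ)
      (fun t => ∫ x, iteratedFDeriv ℝ k (fun s => F s x) t ∂μ) ω := by
  induction k with
  | zero =>
    intro θ _
    simp only [iteratedFDeriv_zero_eq_comp, Function.comp_apply]
    exact ((continuousMultilinearCurryFin0 ℝ (EuclideanSpace ℝ (Fin p)) ℝ).symm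
      |>.toContinuousLinearEquiv.integral_comp_comm _).symm
  | succ k ih =>
    intro θ hθ
    simp only [iteratedFDeriv_succ_eq_comp_left, Function.comp_apply]
    rw [((ih (by omega)).eventuallyEq_of_mem (hω.mem_nhds hθ)).fderiv_eq,
      (hF.hasFDerivAt k (by omega) θ hθ).fderiv]
    exact ((continuousMultilinearCurryLeftEquiv ℝ
      (fun _ : Fin (k + 1) => EuclideanSpace ℝ (Fin p)) ℝ).symm
      |>.toContinuousLinearEquiv.integral_comp_comm _).symm

lemma DiffThriceUnderIntegral.differentiableAt_iteratedFDeriv (hF : DiffThriceUnderIntegral F μ ω)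
    (hω : IsOpen ω) (k : ℕ) (hk : k < 3) {θ : EuclideanSpace ℝ (Fin p)} (hθ : θ ∈ ω) :
    DifferentiableAt ℝ (iteratedFDeriv ℝ k fun t => ∫ x, F t x ∂μ) θ :=
  (hF.hasFDerivAt k hk θ hθ).differentiableAt.congr_of_eventuallyEq
    ((hF.iteratedFDeriv_integral hω k hk.le).eventuallyEq_of_mem (hω.mem_nhds hθ))

/-- The hypothesis provides a third derivative of the integral but not its continuity, which is why
`ThriceDifferentiableOn` replaces `ContDiffOn`. -/
lemma DiffThriceUnderIntegral.thriceDifferentiableOn (hF : DiffThriceUnderIntegral F μ ω)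
    (hω : IsOpen ω) : ThriceDifferentiableOn (fun t => ∫ x, F t x ∂μ) ω := by
  intro θ hθ
  obtain ⟨e₁, he₁⟩ := exists_isometry_iteratedFDeriv_one (EuclideanSpace ℝ (Fin p)) ℝ
  obtain ⟨e₂, he₂⟩ := exists_isometry_iteratedFDeriv_two (EuclideanSpace ℝ (Fin p)) ℝ
  refine ⟨?_, ?_, ?_⟩
  · have := hF.differentiableAt_iteratedFDeriv hω 0 (by norm_num) hθ
    rw [iteratedFDeriv_zero_eq_comp] at this
    exact (LinearIsometryEquiv.comp_differentiableAt_iff _).1 this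
  · have := hF.differentiableAt_iteratedFDeriv hω 1 (by norm_num) hθ
    rw [funext (he₁ fun t => ∫ x, F t x ∂μ)] at this
    exact (LinearIsometryEquiv.comp_differentiableAt_iff e₁).1 this
  · have := hF.differentiableAt_iteratedFDeriv hω 2 (by norm_num) hθ
    rw [funext (he₂ fun t => ∫ x, F t x ∂μ)] at this
    exact (LinearIsometryEquiv.comp_differentiableAt_iff e₂).1 this

lemma DiffThriceUnderIntegral.integrable_fderiv (hF : DiffThriceUnderIntegral F μ ω)
    {θ : EuclideanSpace ℝ (Fin p)} (hθ : θ ∈ ω) :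
    Integrable (fun x => fderiv ℝ (fun t => F t x) θ) μ := by
  obtain ⟨e₁, he₁⟩ := exists_isometry_iteratedFDeriv_one (EuclideanSpace ℝ (Fin p)) ℝ
  have := hF.integrable 1 (by norm_num) θ hθ
  simp_rw [he₁] at this
  exact e₁.toContinuousLinearEquiv.integrable_comp_iff.1 this

lemma DiffThriceUnderIntegral.integrable_fderiv_fderiv (hF : DiffThriceUnderIntegral F μ ω)
    {θ : EuclideanSpace ℝ (Fin p)} (hθ : θ ∈ ω) :
    Integrable (fun x => fderiv ℝ (fderiv ℝ (fun t => F t x)) θ) μ := by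
  obtain ⟨e₂, he₂⟩ := exists_isometry_iteratedFDeriv_two (EuclideanSpace ℝ (Fin p)) ℝ
  have := hF.integrable 2 (by norm_num) θ hθ
  simp_rw [he₂] at this
  exact e₂.toContinuousLinearEquiv.integrable_comp_iff.1 this

lemma DiffThriceUnderIntegral.fderiv_integral (hF : DiffThriceUnderIntegral F μ ω)
    (hω : IsOpen ω) {θ : EuclideanSpace ℝ (Fin p)} (hθ : θ ∈ ω) :
    fderiv ℝ (fun t => ∫ x, F t x ∂μ) θ = ∫ x, fderiv ℝ (fun t => F t x) θ ∂μ := by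
  obtain ⟨e₁, he₁⟩ := exists_isometry_iteratedFDeriv_one (EuclideanSpace ℝ (Fin p)) ℝ
  have := hF.iteratedFDeriv_integral hω 1 (by norm_num) hθ
  simp_rw [he₁] at this
  rw [show ∫ x, e₁ (fderiv ℝ (fun t => F t x) θ) ∂μ = e₁ (∫ x, fderiv ℝ (fun t => F t x) θ ∂μ) from
    e₁.toContinuousLinearEquiv.integral_comp_comm _] at this
  exact e₁.injective this

lemma DiffThriceUnderIntegral.fderiv_fderiv_integral (hF : DiffThriceUnderIntegral F μ ω)
    (hω : IsOpen ω) {θ : EuclideanSpace ℝ (Fin p)} (hθ : θ ∈ ω) :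
    fderiv ℝ (fderiv ℝ (fun t => ∫ x, F t x ∂μ)) θ
      = ∫ x, fderiv ℝ (fderiv ℝ (fun t => F t x)) θ ∂μ := by
  obtain ⟨e₂, he₂⟩ := exists_isometry_iteratedFDeriv_two (EuclideanSpace ℝ (Fin p)) ℝ
  have := hF.iteratedFDeriv_integral hω 2 (by norm_num) hθ
  simp_rw [he₂] at this
  rw [show ∫ x, e₂ (fderiv ℝ (fderiv ℝ (fun t => F t x)) θ) ∂μ
      = e₂ (∫ x, fderiv ℝ (fderiv ℝ (fun t => F t x)) θ ∂μ) from
    e₂.toContinuousLinearEquiv.integral_comp_comm _] at this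
  exact e₂.injective this

end UnderIntegral

/-! ### Derivatives of the loss through the density. -/

section Link

variable {E : Type*} [NormedAddCommGroup E] [NormedSpace ℝ E] {φ : E → ℝ} {ω : Set E} {β : ℝ}

/-- The function `B` with `B'(s) = (1 + β) s ^ (β - 1)` through which the loss depends on the
density at the observation. -/
def powerLink (β s : ℝ) : ℝ := if β = 0 then Real.log s else (1 + 1 / β) * s ^ β

lemma hasDerivAt_powerLink {s : ℝ} (hs : 0 < s) :
    HasDerivAt (powerLink β) ((1 + β) * s ^ (β - 1)) s := by
  unfold powerLink
  rcases eq_or_ne β 0 with rfl | hβ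
  · simp only [if_true]
    convert Real.hasDerivAt_log hs.ne' using 1
    rw [zero_sub, Real.rpow_neg_one]
    ring
  · simp only [hβ, if_false]
    refine ((Real.hasDerivAt_rpow_const (p := β) (Or.inl hs.ne')).const_mul
      (1 + 1 / β)).congr_deriv ?_
    rw [← mul_assoc, add_mul, one_div, inv_mul_cancel₀ hβ]
    ring

lemma contDiffOn_powerLink (hφ : ContDiffOn ℝ 3 φ ω) (hpos : ∀ θ ∈ ω, 0 < φ θ) :
    ContDiffOn ℝ 3 (fun t => powerLink β (φ t)) ω := by
  unfold powerLink
  split_ifs with h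
  · exact hφ.log fun t ht => (hpos t ht).ne'
  · exact contDiffOn_const.mul (hφ.rpow_const_of_ne fun t ht => (hpos t ht).ne')

lemma differentiableAt_of_contDiffOn_three (hω : IsOpen ω) (hφ : ContDiffOn ℝ 3 φ ω) {θ : E}
    (hθ : θ ∈ ω) : DifferentiableAt ℝ φ θ :=
  (hφ.contDiffAt (hω.mem_nhds hθ)).differentiableAt (by norm_num)

lemma fderiv_eq_smul_fderiv_log {θ : E} (hφ : DifferentiableAt ℝ φ θ) (hpos : 0 < φ θ) :
    fderiv ℝ φ θ = φ θ • fderiv ℝ (fun t => Real.log (φ t)) θ := by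
  rw [fderiv.log hφ hpos.ne', smul_smul, mul_inv_cancel₀ hpos.ne', one_smul]

lemma fderiv_powerLink {θ : E} (hφ : DifferentiableAt ℝ φ θ) (hpos : 0 < φ θ) :
    fderiv ℝ (fun t => powerLink β (φ t)) θ
      = ((1 + β) * φ θ ^ β) • fderiv ℝ (fun t => Real.log (φ t)) θ := by
  have h := ((hasDerivAt_powerLink (β := β) hpos).comp_hasFDerivAt θ hφ.hasFDerivAt).fderiv
  rw [show (fun t => powerLink β (φ t)) = powerLink β ∘ φ from rfl, h,
    fderiv_eq_smul_fderiv_log hφ hpos, smul_smul, mul_assoc, Real.rpow_sub_one hpos.ne',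
    div_mul_cancel₀ _ hpos.ne']

lemma fderiv_rpow_one_add {θ : E} (hφ : DifferentiableAt ℝ φ θ) (hpos : 0 < φ θ) :
    fderiv ℝ (fun t => φ t ^ (1 + β)) θ
      = ((1 + β) * φ θ ^ (1 + β)) • fderiv ℝ (fun t => Real.log (φ t)) θ := by
  have h := ((Real.hasDerivAt_rpow_const (p := 1 + β) (Or.inl hpos.ne')).comp_hasFDerivAt θ
    hφ.hasFDerivAt).fderiv
  rw [show (fun t => φ t ^ (1 + β)) = (fun s => s ^ (1 + β)) ∘ φ from rfl, h,
    fderiv_eq_smul_fderiv_log hφ hpos, smul_smul, mul_assoc, Real.rpow_sub_one hpos.ne',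
    div_mul_cancel₀ _ hpos.ne']

/-- This is the product rule applied to D(φ^(1+β)) = φ D(B ∘ φ), with B = `powerLink β`; it holds
for β = 0 and β > 0 alike. -/
lemma smul_fderiv_fderiv_powerLink (hω : IsOpen ω) (hφ : ContDiffOn ℝ 3 φ ω)
    (hpos : ∀ θ ∈ ω, 0 < φ θ) {θ : E} (hθ : θ ∈ ω) :
    φ θ • fderiv ℝ (fderiv ℝ (fun t => powerLink β (φ t))) θ
      = fderiv ℝ (fderiv ℝ (fun t => φ t ^ (1 + β))) θ
        - ((1 + β) * φ θ ^ (1 + β)) • (fderiv ℝ (fun t => Real.log (φ t)) θ).smulRight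
            (fderiv ℝ (fun t => Real.log (φ t)) θ) := by
  have hd := fun t ht => differentiableAt_of_contDiffOn_three hω hφ (θ := t) ht
  have heq : Set.EqOn (fderiv ℝ (fun t => φ t ^ (1 + β)))
      (fun t => φ t • fderiv ℝ (fun t => powerLink β (φ t)) t) ω := by
    intro t ht
    simp only
    rw [fderiv_rpow_one_add (hd t ht) (hpos t ht), fderiv_powerLink (hd t ht) (hpos t ht),
      smul_smul, Real.rpow_add (hpos t ht), Real.rpow_one]
    ring_nf
  have hw := (ThriceDifferentiableOn.of_contDiffOn hω
    (contDiffOn_powerLink (β := β) hφ hpos) θ hθ).2.1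
  rw [fderiv_eventuallyEq_of_eqOn hω heq hθ, fderiv_fun_smul (hd θ hθ) hw,
    fderiv_powerLink (hd θ hθ) (hpos θ hθ), fderiv_eq_smul_fderiv_log (hd θ hθ) (hpos θ hθ),
    eq_sub_iff_add_eq, Real.rpow_add (hpos θ hθ), Real.rpow_one]
  congr 1
  ext a b
  simp only [_root_.smul_apply, ContinuousLinearMap.smulRight_apply, smul_eq_mul]
  ring

end Link

/-! ### Scores, integrability, and the matrix J at the true parameter. -/

section Model

lemma inner_gradient_eq {E : Type*} [NormedAddCommGroup E] [InnerProductSpace ℝ E]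
    [CompleteSpace E] (h : E → ℝ) (θ v : E) : inner ℝ (gradient h θ) v = fderiv ℝ h θ v := by
  rw [gradient, InnerProductSpace.toDual_symm_apply]

lemma score_apply {p : ℕ} {𝓧 : Type*} (f : EuclideanSpace ℝ (Fin p) → 𝓧 → ℝ) (θ : EuclideanSpace ℝ (Fin p)) (x : 𝓧)
    (i : Fin p) : score f θ x i
      = fderiv ℝ (fun t => Real.log (f t x)) θ (EuclideanSpace.single i 1) := by
  rw [← inner_gradient_eq, EuclideanSpace.inner_single_right]
  simp [score]

lemma norm_fderiv_log_sq {p : ℕ} {𝓧 : Type*} (f : EuclideanSpace ℝ (Fin p) → 𝓧 → ℝ) (θ : EuclideanSpace ℝ (Fin p))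
    (x : 𝓧) : ‖fderiv ℝ (fun t => Real.log (f t x)) θ‖ ^ 2 = ∑ i, score f θ x i ^ 2 := by
  have : ‖score f θ x‖ = ‖fderiv ℝ (fun t => Real.log (f t x)) θ‖ := by
    simp [score, gradient]
  rw [← this, EuclideanSpace.real_norm_sq_eq]

variable {p : ℕ} {𝓧 : Type*} [MeasurableSpace 𝓧] {μ : Measure 𝓧}
  {f : EuclideanSpace ℝ (Fin p) → 𝓧 → ℝ} {Θ ω : Set (EuclideanSpace ℝ (Fin p))}
  {θ₀ θ : EuclideanSpace ℝ (Fin p)} {β : ℝ}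

/-- Common support leaves two cases at each x: smooth logarithms and powers on all of ω, or
functions vanishing identically there. -/
lemma IsDensityModel.pos_or_eq_zero (hf : IsDensityModel f μ Θ)
    (hreg : RegularityConditions f μ Θ β (f θ₀) θ₀ ω) (x : 𝓧) :
    (∀ θ ∈ ω, 0 < f θ x) ∨ ∀ θ ∈ ω, f θ x = 0 := by
  by_cases h : 0 < f θ₀ x
  · exact Or.inl fun θ hθ => (hreg.common_support θ (hreg.subset hθ) x).2 h
  · refine Or.inr fun θ hθ => le_antisymm (not_lt.1 fun h' => h ?_)
      (hf.nonneg θ (hreg.subset hθ) x)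
    exact (hreg.common_support θ (hreg.subset hθ) x).1 h'

lemma ae_fderiv_rpow_model (hf : IsDensityModel f μ Θ) (hβ : 0 ≤ β)
    (hreg : RegularityConditions f μ Θ β (f θ₀) θ₀ ω) :
    ∀ᵐ x ∂μ, ∀ θ ∈ ω, fderiv ℝ (fun t => f t x ^ (1 + β)) θ
      = ((1 + β) * f θ x ^ (1 + β)) • fderiv ℝ (fun t => Real.log (f t x)) θ := by
  filter_upwards [hreg.smooth] with x hx θ hθ
  rcases hf.pos_or_eq_zero hreg x with h | h
  · exact fderiv_rpow_one_add (differentiableAt_of_contDiffOn_three hreg.isOpen hx hθ) (h θ hθ)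
  · have hne : 1 + β ≠ 0 := by positivity
    have h0 : Set.EqOn (fun t => f t x ^ (1 + β)) (fun _ => 0) ω := fun t ht => by
      simp [h t ht, Real.zero_rpow hne]
    rw [fderiv_eventuallyEq_of_eqOn hreg.isOpen h0 hθ, h θ hθ, Real.zero_rpow hne]
    simp

lemma ae_fderiv_rpow_model_apply (hf : IsDensityModel f μ Θ) (hβ : 0 ≤ β)
    (hreg : RegularityConditions f μ Θ β (f θ₀) θ₀ ω) :
    ∀ᵐ x ∂μ, ∀ θ ∈ ω, ∀ i, fderiv ℝ (fun t => f t x ^ (1 + β)) θ (EuclideanSpace.single i 1)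
      = (1 + β) * (score f θ x i * f θ x ^ (1 + β)) := by
  filter_upwards [ae_fderiv_rpow_model hf hβ hreg] with x hx θ hθ i
  rw [hx θ hθ, _root_.smul_apply, score_apply, smul_eq_mul]
  ring

lemma integrable_score_mul_rpow (hf : IsDensityModel f μ Θ) (hβ : 0 ≤ β)
    (hreg : RegularityConditions f μ Θ β (f θ₀) θ₀ ω) (hθ : θ ∈ ω) (i : Fin p) :
    Integrable (fun x => score f θ x i * f θ x ^ (1 + β)) μ := by
  have h := ((hreg.diff_integral_model.integrable_fderiv hθ).apply_continuousLinearMap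
    (EuclideanSpace.single i 1)).const_mul (1 + β)⁻¹
  refine h.congr ?_
  filter_upwards [ae_fderiv_rpow_model_apply hf hβ hreg] with x hx
  rw [hx θ hθ i]
  have hne : 1 + β ≠ 0 := by positivity
  field_simp

lemma fderiv_integral_model_apply (hf : IsDensityModel f μ Θ) (hβ : 0 ≤ β)
    (hreg : RegularityConditions f μ Θ β (f θ₀) θ₀ ω) (hθ : θ ∈ ω) (i : Fin p) :
    fderiv ℝ (fun t => ∫ x, f t x ^ (1 + β) ∂μ) θ (EuclideanSpace.single i 1)
      = (1 + β) * ∫ x, score f θ x i * f θ x ^ (1 + β) ∂μ := by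
  rw [hreg.diff_integral_model.fderiv_integral hreg.isOpen hθ,
    ContinuousLinearMap.integral_apply (hreg.diff_integral_model.integrable_fderiv hθ),
    ← integral_const_mul]
  refine integral_congr_ae ?_
  filter_upwards [ae_fderiv_rpow_model_apply hf hβ hreg] with x hx
  exact hx θ hθ i

lemma rpow_mul_rpow_of_nonneg (hβ : 0 ≤ β) {s : ℝ} (hs : 0 ≤ s) : s ^ β * s = s ^ (1 + β) := by
  rw [add_comm, Real.rpow_add_one' hs (by positivity)]

/-- Integrals with respect to the law with density `f θ₀`. -/
lemma integral_withDensity_model {F : Type*} [NormedAddCommGroup F] [NormedSpace ℝ F]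
    (hf : IsDensityModel f μ Θ) (hθ : θ ∈ Θ) (h : 𝓧 → F) :
    ∫ x, h x ∂(μ.withDensity fun x => ENNReal.ofReal (f θ x)) = ∫ x, f θ x • h x ∂μ := by
  rw [integral_withDensity_eq_integral_toReal_smul (hf.measurable θ hθ).ennreal_ofReal
    (ae_of_all _ fun _ => ENNReal.ofReal_lt_top)]
  simp [ENNReal.toReal_ofReal (hf.nonneg θ hθ _)]

lemma integrable_withDensity_model_iff {F : Type*} [NormedAddCommGroup F] [NormedSpace ℝ F]
    (hf : IsDensityModel f μ Θ) (hθ : θ ∈ Θ) {h : 𝓧 → F} :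
    Integrable h (μ.withDensity fun x => ENNReal.ofReal (f θ x))
      ↔ Integrable (fun x => f θ x • h x) μ := by
  rw [integrable_withDensity_iff_integrable_smul' (hf.measurable θ hθ).ennreal_ofReal
    (ae_of_all _ fun _ => ENNReal.ofReal_lt_top)]
  simp [ENNReal.toReal_ofReal (hf.nonneg θ hθ _)]

lemma ae_withDensity_model (hf : IsDensityModel f μ Θ) (hθ : θ ∈ Θ) {q : 𝓧 → Prop}
    (hq : ∀ᵐ x ∂μ, 0 < f θ x → q x) :
    ∀ᵐ x ∂(μ.withDensity fun x => ENNReal.ofReal (f θ x)), q x := by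
  rw [ae_withDensity_iff (hf.measurable θ hθ).ennreal_ofReal]
  filter_upwards [hq] with x hx h
  exact hx (by simpa using h)

lemma isProbabilityMeasure_withDensity_model (hf : IsDensityModel f μ Θ) (hθ : θ ∈ Θ) :
    IsProbabilityMeasure (μ.withDensity fun x => ENNReal.ofReal (f θ x)) :=
  ⟨by simpa using hf.lintegral_eq_one θ hθ⟩

/-- At g = f_θ₀ the factor g - f_θ₀ kills the second integral. -/
lemma matJ_model_apply (f : EuclideanSpace ℝ (Fin p) → 𝓧 → ℝ) (μ : Measure 𝓧) (β : ℝ)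
    (θ₀ : EuclideanSpace ℝ (Fin p)) (i j : Fin p) :
    matJ f μ β (f θ₀) θ₀ i j = ∫ x, score f θ₀ x i * score f θ₀ x j * f θ₀ x ^ (1 + β) ∂μ := by
  simp [matJ]

/-- A non-integrable function has integral 0 by convention, which would contradict the positive
diagonal of J. -/
lemma integrable_score_sq (hreg : RegularityConditions f μ Θ β (f θ₀) θ₀ ω) (i : Fin p) :
    Integrable (fun x => score f θ₀ x i ^ 2 * f θ₀ x ^ (1 + β)) μ := by
  by_contra h
  have hJ := hreg.posDef.diag_pos (i := i)
  rw [matJ_model_apply] at hJ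
  simp_rw [← pow_two] at hJ
  rw [integral_undef h] at hJ
  exact lt_irrefl _ hJ

/-- The outer product of the score at `θ₀`, weighted by `f ^ (1 + β)`, as a bilinear form. -/
def scoreForm (f : EuclideanSpace ℝ (Fin p) → 𝓧 → ℝ) (β : ℝ) (θ₀ : EuclideanSpace ℝ (Fin p))
    (x : 𝓧) : EuclideanSpace ℝ (Fin p) →L[ℝ] EuclideanSpace ℝ (Fin p) →L[ℝ] ℝ :=
  ((1 + β) * f θ₀ x ^ (1 + β)) • (fderiv ℝ (fun t => Real.log (f t x)) θ₀).smulRight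
    (fderiv ℝ (fun t => Real.log (f t x)) θ₀)

/-- Measurability is drawn from D = D(f^(1+β)), as the form equals D ⊗ D / ((1+β) f^(1+β)), with
both sides 0 where f vanishes. The norm of a rank-one form u uᵀ is ∑ uᵢ², so the diagonal of J
dominates. -/
lemma integrable_scoreForm (hf : IsDensityModel f μ Θ) (hβ : 0 ≤ β)
    (hreg : RegularityConditions f μ Θ β (f θ₀) θ₀ ω) : Integrable (scoreForm f β θ₀) μ := by
  have hne : 1 + β ≠ 0 := by positivity
  have hD := (hreg.diff_integral_model.integrable_fderiv hreg.mem).aestronglyMeasurable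
  have hm : AEStronglyMeasurable (fun x => ((1 + β) * f θ₀ x ^ (1 + β))⁻¹ •
      (fderiv ℝ (fun t => f t x ^ (1 + β)) θ₀).smulRight
        (fderiv ℝ (fun t => f t x ^ (1 + β)) θ₀)) μ := by
    refine AEStronglyMeasurable.smul (𝕜 := ℝ) ?_ ?_
    · exact (((hf.measurable θ₀ (hreg.subset hreg.mem)).pow_const _).const_mul
        _).inv.aestronglyMeasurable
    · exact (ContinuousLinearMap.smulRightL ℝ (EuclideanSpace ℝ (Fin p))
        (EuclideanSpace ℝ (Fin p) →L[ℝ] ℝ)).aestronglyMeasurable_comp₂ hD hD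
  have hint : Integrable (fun x => (1 + β) * ∑ i, score f θ₀ x i ^ 2 * f θ₀ x ^ (1 + β)) μ :=
    (integrable_finsetSum _ fun i _ => integrable_score_sq hreg i).const_mul _
  refine hint.mono' (hm.congr ?_) ?_
  · filter_upwards [ae_fderiv_rpow_model hf hβ hreg] with x hx
    rw [hx θ₀ hreg.mem, scoreForm]
    ext a b
    simp only [_root_.smul_apply, ContinuousLinearMap.smulRight_apply, smul_eq_mul]
    rcases eq_or_ne (f θ₀ x ^ (1 + β)) 0 with h | h
    · simp [h]
    · field_simp
  · refine ae_of_all _ fun x => ?_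
    have h0 : 0 ≤ f θ₀ x ^ (1 + β) :=
      Real.rpow_nonneg (hf.nonneg θ₀ (hreg.subset hreg.mem) x) _
    rw [scoreForm, norm_smul, ContinuousLinearMap.norm_smulRight_apply, ← pow_two,
      norm_fderiv_log_sq, Real.norm_of_nonneg (by positivity), ← Finset.sum_mul]
    apply le_of_eq
    ring

lemma integral_scoreForm_apply (hf : IsDensityModel f μ Θ) (hβ : 0 ≤ β)
    (hreg : RegularityConditions f μ Θ β (f θ₀) θ₀ ω) (i j : Fin p) :
    (∫ x, scoreForm f β θ₀ x ∂μ) (EuclideanSpace.single j 1) (EuclideanSpace.single i 1)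
      = (1 + β) * matJ f μ β (f θ₀) θ₀ i j := by
  have h := integrable_scoreForm hf hβ hreg
  rw [ContinuousLinearMap.integral_apply h,
    ContinuousLinearMap.integral_apply (h.apply_continuousLinearMap _), matJ_model_apply,
    ← integral_const_mul]
  congr 1
  ext x
  simp only [scoreForm, _root_.smul_apply, ContinuousLinearMap.smulRight_apply, smul_eq_mul,
    score_apply]
  ring

end Model

/-! ### Whitening and the quadratic form of the Wald statistic. -/

section Algebra

open Matrix

variable {p : ℕ}

open scoped MatrixOrder in
/-- An invertible covariance matrix can be whitened. -/
lemma exists_whitening {K : Matrix (Fin p) (Fin p) ℝ} (hK : K.PosSemidef) (hu : IsUnit K) :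
    ∃ R : Matrix (Fin p) (Fin p) ℝ, Rᵀ * R = K⁻¹ ∧ R * K * Rᵀ = 1 := by
  obtain ⟨R, hR⟩ := CStarAlgebra.nonneg_iff_eq_star_mul_self.mp hK.inv.nonneg
  have hR' : Rᵀ * R = K⁻¹ := by
    rw [hR, star_eq_conjTranspose, conjTranspose_eq_transpose_of_trivial]
  refine ⟨R, hR', ?_⟩
  have h1 : K * Rᵀ * R = 1 := by
    rw [Matrix.mul_assoc, hR', mul_nonsing_inv _ ((isUnit_iff_isUnit_det K).1 hu)]
  rw [Matrix.mul_assoc]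
  exact mul_eq_one_comm.1 h1

/-- The Wald-type statistic is the squared norm of a linear image of the estimation error. -/
lemma waldStat_eq_norm_sq {J K R : Matrix (Fin p) (Fin p) ℝ} (hJ : Jᵀ = J) (hJu : IsUnit J)
    (hR : Rᵀ * R = K⁻¹) (θ₀ θ : EuclideanSpace ℝ (Fin p)) (n : ℕ) :
    waldStat J K θ₀ n θ
      = ‖-(√(n : ℝ) • toEuclideanCLM (𝕜 := ℝ) (-(R * J)) (θ - θ₀))‖ ^ 2 := by
  have hdet := (isUnit_iff_isUnit_det J).1 hJu
  have h1 : (J⁻¹ * K * J⁻¹)⁻¹ = (R * J)ᵀ * (R * J) := by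
    rw [Matrix.mul_inv_rev, Matrix.mul_inv_rev, nonsing_inv_nonsing_inv _ hdet, ← hR,
      transpose_mul, hJ]
    simp only [Matrix.mul_assoc]
  rw [norm_neg, norm_smul, mul_pow, Real.norm_eq_abs, sq_abs, Real.sq_sqrt (Nat.cast_nonneg n),
    waldStat, h1, map_neg, _root_.neg_apply, norm_neg, ← real_inner_self_eq_norm_sq,
    EuclideanSpace.inner_eq_star_dotProduct, ofLp_toEuclideanCLM, star_trivial,
    ← mulVec_mulVec, dotProduct_mulVec, vecMul_transpose]

/-- The invertible linear map of an invertible matrix. -/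
lemma exists_continuousLinearEquiv_toEuclideanCLM {B : Matrix (Fin p) (Fin p) ℝ} (hB : IsUnit B) :
    ∃ A : EuclideanSpace ℝ (Fin p) ≃L[ℝ] EuclideanSpace ℝ (Fin p),
      (A : EuclideanSpace ℝ (Fin p) →L[ℝ] EuclideanSpace ℝ (Fin p))
        = toEuclideanCLM (𝕜 := ℝ) B :=
  ⟨ContinuousLinearEquiv.unitsEquiv ℝ _ (hB.map (toEuclideanCLM (n := Fin p) (𝕜 := ℝ))).unit, rfl⟩

/-- The coordinates of a linear form in the standard basis. -/
def coordMap (p : ℕ) :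
    (EuclideanSpace ℝ (Fin p) →L[ℝ] ℝ) →L[ℝ] EuclideanSpace ℝ (Fin p) :=
  LinearMap.toContinuousLinearMap
    { toFun := fun l => WithLp.toLp 2 fun i => l (EuclideanSpace.single i 1)
      map_add' := fun _ _ => rfl
      map_smul' := fun _ _ => rfl }

lemma coordMap_apply (l : EuclideanSpace ℝ (Fin p) →L[ℝ] ℝ) (i : Fin p) :
    coordMap p l i = l (EuclideanSpace.single i 1) := rfl

lemma coordMap_comp_eq_toEuclideanCLM {S : EuclideanSpace ℝ (Fin p) →L[ℝ]
      EuclideanSpace ℝ (Fin p) →L[ℝ] ℝ} {J : Matrix (Fin p) (Fin p) ℝ}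
    (h : ∀ i j, S (EuclideanSpace.single j 1) (EuclideanSpace.single i 1) = J i j) :
    coordMap p ∘L S = toEuclideanCLM (𝕜 := ℝ) J := by
  refine ContinuousLinearMap.coe_injective ((EuclideanSpace.basisFun (Fin p) ℝ).toBasis.ext ?_)
  intro j
  ext i
  simp [coordMap_apply, h]

end Algebra

/-! ### The centred score: gradient of the loss, mean, covariance. -/

section Model

variable {p : ℕ} {𝓧 : Type*} [MeasurableSpace 𝓧] {μ : Measure 𝓧}
  {f : EuclideanSpace ℝ (Fin p) → 𝓧 → ℝ} {Θ ω : Set (EuclideanSpace ℝ (Fin p))}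
  {θ₀ θ : EuclideanSpace ℝ (Fin p)} {β : ℝ}

/-- The contribution of one observation to the estimating function. -/
def centeredScore (f : EuclideanSpace ℝ (Fin p) → 𝓧 → ℝ) (μ : Measure 𝓧) (β : ℝ)
    (θ : EuclideanSpace ℝ (Fin p)) (x : 𝓧) : EuclideanSpace ℝ (Fin p) :=
  WithLp.toLp 2 fun i => score f θ x i * f θ x ^ β - ∫ y, score f θ y i * f θ y ^ (1 + β) ∂μ

/-- For n = 0 the empirical mean is 0, while the integral term stays in `estimatingFun`. -/
lemma ofLp_empMean_centeredScore (f : EuclideanSpace ℝ (Fin p) → 𝓧 → ℝ) (μ : Measure 𝓧) (β : ℝ)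
    {n : ℕ} (hn : n ≠ 0) (x : Fin n → 𝓧) (θ : EuclideanSpace ℝ (Fin p)) :
    (empMean (centeredScore f μ β θ) x).ofLp = estimatingFun f μ β x θ := by
  have hn' : (n : ℝ) ≠ 0 := Nat.cast_ne_zero.2 hn
  ext k
  simp [empMean, centeredScore, estimatingFun, Finset.sum_sub_distrib]
  field_simp

lemma integral_model_eq_one (hf : IsDensityModel f μ Θ) (hθ : θ ∈ Θ) : ∫ x, f θ x ∂μ = 1 := by
  rw [integral_eq_lintegral_of_nonneg_ae (ae_of_all _ (hf.nonneg θ hθ))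
    (hf.measurable θ hθ).aestronglyMeasurable, hf.lintegral_eq_one θ hθ, ENNReal.toReal_one]

/-- Since ∫ f_θ = 1, the case β = 0 has the same shape as β > 0 with c = 1; the constant disappears
on differentiation. -/
lemma lossV_eqOn (hf : IsDensityModel f μ Θ) (hω : ω ⊆ Θ) (x : 𝓧) :
    ∃ c : ℝ, Set.EqOn (fun t => lossV f μ β t x)
      ((fun t => (∫ y, f t y ^ (1 + β) ∂μ) - c) - fun t => powerLink β (f t x)) ω := by
  rcases eq_or_ne β 0 with rfl | hβ
  · refine ⟨1, fun t ht => ?_⟩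
    simp [lossV, powerLink, integral_model_eq_one hf (hω ht)]
  · exact ⟨0, fun t ht => by simp [lossV, powerLink, hβ]⟩

lemma thriceDifferentiableOn_sub_const {E : Type*} [NormedAddCommGroup E] [NormedSpace ℝ E]
    {V : E → ℝ} {ω : Set E} (hV : ThriceDifferentiableOn V ω) (c : ℝ) :
    ThriceDifferentiableOn (fun t => V t - c) ω := by
  have h : fderiv ℝ (fun t => V t - c) = fderiv ℝ V := by
    ext1 t
    exact fderiv_sub_const c
  intro θ hθ
  rw [h]
  exact ⟨(hV θ hθ).1.sub_const c, (hV θ hθ).2⟩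

lemma lossV_regular (hf : IsDensityModel f μ Θ)
    (hreg : RegularityConditions f μ Θ β (f θ₀) θ₀ ω) {x : 𝓧}
    (hx : ContDiffOn ℝ 3 (fun t => f t x) ω) (hpos : ∀ θ ∈ ω, 0 < f θ x) :
    ThriceDifferentiableOn (fun t => lossV f μ β t x) ω ∧
    Set.EqOn (fderiv ℝ fun t => lossV f μ β t x)
      (fderiv ℝ (fun t => ∫ y, f t y ^ (1 + β) ∂μ)
        - fderiv ℝ fun t => powerLink β (f t x)) ω ∧
    Set.EqOn (fderiv ℝ (fderiv ℝ fun t => lossV f μ β t x))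
      (fderiv ℝ (fderiv ℝ (fun t => ∫ y, f t y ^ (1 + β) ∂μ))
        - fderiv ℝ (fderiv ℝ fun t => powerLink β (f t x))) ω := by
  obtain ⟨c, hc⟩ := lossV_eqOn (β := β) hf hreg.subset x
  have hω := hreg.isOpen
  have hC := thriceDifferentiableOn_sub_const
    (hreg.diff_integral_model.thriceDifferentiableOn hω) c
  have hw := ThriceDifferentiableOn.of_contDiffOn hω (contDiffOn_powerLink (β := β) hx hpos)
  have hCd : fderiv ℝ (fun t => (∫ y, f t y ^ (1 + β) ∂μ) - c)
      = fderiv ℝ fun t => ∫ y, f t y ^ (1 + β) ∂μ := by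
    ext1 t
    exact fderiv_sub_const c
  have h1 := fderiv_eventuallyEq_of_eqOn hω hc
  refine ⟨(hC.sub hω hw).congr hω hc, ?_, ?_⟩
  · have := h1.trans (hC.fderiv_sub hw)
    rwa [hCd] at this
  · have := (fderiv_eventuallyEq_of_eqOn hω h1).trans (hC.fderiv_fderiv_sub hω hw)
    rwa [hCd] at this

lemma coordMap_fderiv_lossV (hf : IsDensityModel f μ Θ) (hβ : 0 ≤ β)
    (hreg : RegularityConditions f μ Θ β (f θ₀) θ₀ ω) {x : 𝓧}
    (hx : ContDiffOn ℝ 3 (fun t => f t x) ω) (hpos : ∀ θ ∈ ω, 0 < f θ x) (hθ : θ ∈ ω) :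
    coordMap p (fderiv ℝ (fun t => lossV f μ β t x) θ) = -(1 + β) • centeredScore f μ β θ x := by
  ext i
  rw [coordMap_apply, (lossV_regular hf hreg hx hpos).2.1 hθ, Pi.sub_apply, _root_.sub_apply,
    fderiv_integral_model_apply hf hβ hreg hθ,
    fderiv_powerLink (differentiableAt_of_contDiffOn_three hreg.isOpen hx hθ) (hpos θ hθ),
    _root_.smul_apply, ← score_apply]
  simp [centeredScore]
  ring

lemma ae_smul_hessian_powerLink (hf : IsDensityModel f μ Θ) (hβ : 0 ≤ β)
    (hreg : RegularityConditions f μ Θ β (f θ₀) θ₀ ω) :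
    ∀ᵐ x ∂μ, f θ₀ x • fderiv ℝ (fderiv ℝ (fun t => powerLink β (f t x))) θ₀
      = fderiv ℝ (fderiv ℝ (fun t => f t x ^ (1 + β))) θ₀ - scoreForm f β θ₀ x := by
  filter_upwards [hreg.smooth] with x hx
  rcases hf.pos_or_eq_zero hreg x with h | h
  · exact smul_fderiv_fderiv_powerLink hreg.isOpen hx h hreg.mem
  · have hne : 1 + β ≠ 0 := by positivity
    have h0 : Set.EqOn (fun t => f t x ^ (1 + β)) (fun _ => 0) ω := fun t ht => by
      simp [h t ht, Real.zero_rpow hne]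
    have h1 := fderiv_eventuallyEq_of_eqOn hreg.isOpen h0
    have h2 := fderiv_eventuallyEq_of_eqOn hreg.isOpen h1 hreg.mem
    rw [h2, scoreForm, h θ₀ hreg.mem, Real.zero_rpow hne]
    simp

lemma ae_contDiffOn_and_pos (hf : IsDensityModel f μ Θ)
    (hreg : RegularityConditions f μ Θ β (f θ₀) θ₀ ω) :
    ∀ᵐ x ∂(μ.withDensity fun x => ENNReal.ofReal (f θ₀ x)),
      ContDiffOn ℝ 3 (fun t => f t x) ω ∧ ∀ θ ∈ ω, 0 < f θ x := by
  refine ae_withDensity_model hf (hreg.subset hreg.mem) ?_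
  filter_upwards [hreg.smooth] with x hx hpos
  exact ⟨hx, fun θ hθ => (hreg.common_support θ (hreg.subset hθ) x).2 hpos⟩

/-- The information identity: the Hessian of ∫ f^(1+β) cancels ∫ D²(f^(1+β)), and only the outer
product of scores survives. -/
lemma integrable_integral_hessian_lossV (hf : IsDensityModel f μ Θ) (hβ : 0 ≤ β)
    (hreg : RegularityConditions f μ Θ β (f θ₀) θ₀ ω) :
    Integrable (fun x => fderiv ℝ (fderiv ℝ fun t => lossV f μ β t x) θ₀)
        (μ.withDensity fun x => ENNReal.ofReal (f θ₀ x)) ∧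
      ∫ x, fderiv ℝ (fderiv ℝ fun t => lossV f μ β t x) θ₀
        ∂(μ.withDensity fun x => ENNReal.ofReal (f θ₀ x)) = ∫ x, scoreForm f β θ₀ x ∂μ := by
  have hθ₀ := hreg.subset hreg.mem
  have := isProbabilityMeasure_withDensity_model hf hθ₀
  have hD := hreg.diff_integral_model.integrable_fderiv_fderiv hreg.mem
  have hS := integrable_scoreForm hf hβ hreg
  have hw := (integrable_withDensity_model_iff hf hθ₀).2
    ((hD.sub hS).congr ((ae_smul_hessian_powerLink hf hβ hreg).mono fun x hx => hx.symm))
  have heq : (fun x => fderiv ℝ (fderiv ℝ fun t => lossV f μ β t x) θ₀)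
      =ᵐ[μ.withDensity fun x => ENNReal.ofReal (f θ₀ x)]
      fun x => fderiv ℝ (fderiv ℝ (fun t => ∫ y, f t y ^ (1 + β) ∂μ)) θ₀
        - fderiv ℝ (fderiv ℝ fun t => powerLink β (f t x)) θ₀ := by
    filter_upwards [ae_contDiffOn_and_pos hf hreg] with x hx
    exact (lossV_regular hf hreg hx.1 hx.2).2.2 hreg.mem
  refine ⟨((integrable_const _).sub hw).congr heq.symm, ?_⟩
  rw [integral_congr_ae heq, integral_sub (integrable_const _) hw, integral_const,
    integral_withDensity_model hf hθ₀, integral_congr_ae (ae_smul_hessian_powerLink hf hβ hreg),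
    integral_sub hD hS, hreg.diff_integral_model.fderiv_fderiv_integral hreg.isOpen hreg.mem]
  simp

/-- Under the true law f_θ is almost surely positive, so the score term is the integrable function u
f^(1+β) divided by f. -/
lemma aemeasurable_centeredScore (hf : IsDensityModel f μ Θ) (hβ : 0 ≤ β)
    (hreg : RegularityConditions f μ Θ β (f θ₀) θ₀ ω) (hθ : θ ∈ ω) :
    AEMeasurable (centeredScore f μ β θ) (μ.withDensity fun x => ENNReal.ofReal (f θ₀ x)) := by
  have hm : AEMeasurable (fun x => WithLp.toLp 2 fun i : Fin p =>
      (score f θ x i * f θ x ^ (1 + β)) / f θ x - ∫ y, score f θ y i * f θ y ^ (1 + β) ∂μ) μ := by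
    refine (WithLp.measurable_toLp 2 (Fin p → ℝ)).comp_aemeasurable
      (aemeasurable_pi_iff.2 fun i => ?_)
    exact (((integrable_score_mul_rpow hf hβ hreg hθ i).aemeasurable).div
      (hf.measurable θ (hreg.subset hθ)).aemeasurable).sub_const _
  refine (hm.mono_ac (withDensity_absolutelyContinuous _ _)).congr ?_
  filter_upwards [ae_contDiffOn_and_pos hf hreg] with x hx
  have hpos := hx.2 θ hθ
  ext i
  simp only [centeredScore]
  rw [Real.rpow_add hpos, Real.rpow_one]
  field_simp

lemma integrable_score_mul_rpow_withDensity (hf : IsDensityModel f μ Θ) (hβ : 0 ≤ β)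
    (hreg : RegularityConditions f μ Θ β (f θ₀) θ₀ ω) (i : Fin p) :
    Integrable (fun x => score f θ₀ x i * f θ₀ x ^ β)
        (μ.withDensity fun x => ENNReal.ofReal (f θ₀ x)) ∧
      ∫ x, score f θ₀ x i * f θ₀ x ^ β ∂(μ.withDensity fun x => ENNReal.ofReal (f θ₀ x))
        = ∫ x, score f θ₀ x i * f θ₀ x ^ (1 + β) ∂μ := by
  have hθ₀ := hreg.subset hreg.mem
  have e : ∀ x, f θ₀ x • (score f θ₀ x i * f θ₀ x ^ β) = score f θ₀ x i * f θ₀ x ^ (1 + β) := by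
    intro x
    rw [← rpow_mul_rpow_of_nonneg hβ (hf.nonneg θ₀ hθ₀ x), smul_eq_mul]
    ring
  constructor
  · rw [integrable_withDensity_model_iff hf hθ₀]
    simp_rw [e]
    exact integrable_score_mul_rpow hf hβ hreg hreg.mem i
  · rw [integral_withDensity_model hf hθ₀]
    simp_rw [e]

lemma integrable_integral_centeredScore (hf : IsDensityModel f μ Θ) (hβ : 0 ≤ β)
    (hreg : RegularityConditions f μ Θ β (f θ₀) θ₀ ω) (i : Fin p) :
    Integrable (fun x => centeredScore f μ β θ₀ x i)
        (μ.withDensity fun x => ENNReal.ofReal (f θ₀ x)) ∧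
      ∫ x, centeredScore f μ β θ₀ x i ∂(μ.withDensity fun x => ENNReal.ofReal (f θ₀ x)) = 0 := by
  have := isProbabilityMeasure_withDensity_model hf (hreg.subset hreg.mem)
  obtain ⟨h1, h2⟩ := integrable_score_mul_rpow_withDensity hf hβ hreg i
  refine ⟨h1.sub (integrable_const _), ?_⟩
  change ∫ x, (score f θ₀ x i * f θ₀ x ^ β - ∫ y, score f θ₀ y i * f θ₀ y ^ (1 + β) ∂μ) ∂_ = 0
  rw [integral_sub h1 (integrable_const _), h2]
  simp

/-- `matK` is the covariance matrix of the estimating function at the true parameter. -/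
lemma integrable_integral_centeredScore_mul (hf : IsDensityModel f μ Θ) (hβ : 0 ≤ β)
    (hreg : RegularityConditions f μ Θ β (f θ₀) θ₀ ω)
    (hK_fin : ∀ i j, Integrable (fun x => score f θ₀ x i * score f θ₀ x j
      * f θ₀ x ^ (2 * β) * f θ₀ x) μ) (i j : Fin p) :
    Integrable (fun x => centeredScore f μ β θ₀ x i * centeredScore f μ β θ₀ x j)
        (μ.withDensity fun x => ENNReal.ofReal (f θ₀ x)) ∧
      ∫ x, centeredScore f μ β θ₀ x i * centeredScore f μ β θ₀ x j
        ∂(μ.withDensity fun x => ENNReal.ofReal (f θ₀ x)) = matK f μ β (f θ₀) θ₀ i j := by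
  have hθ₀ := hreg.subset hreg.mem
  have := isProbabilityMeasure_withDensity_model hf hθ₀
  set ν := μ.withDensity fun x => ENNReal.ofReal (f θ₀ x) with hν
  set ξ : Fin p → ℝ := fun i => ∫ y, score f θ₀ y i * f θ₀ y ^ (1 + β) ∂μ with hξ
  set a : Fin p → 𝓧 → ℝ := fun i x => score f θ₀ x i * f θ₀ x ^ β with ha
  have ha_int : ∀ i, Integrable (a i) ν ∧ ∫ x, a i x ∂ν = ξ i :=
    integrable_score_mul_rpow_withDensity hf hβ hreg
  have hξ' : ∀ i, vecXi f μ β (f θ₀) θ₀ i = ξ i := by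
    intro i
    simp only [vecXi, hξ, mul_assoc, rpow_mul_rpow_of_nonneg hβ (hf.nonneg θ₀ hθ₀ _)]
  have e : ∀ x, f θ₀ x • (a i x * a j x)
      = score f θ₀ x i * score f θ₀ x j * f θ₀ x ^ (2 * β) * f θ₀ x := by
    intro x
    have : f θ₀ x ^ (2 * β) = f θ₀ x ^ β * f θ₀ x ^ β := by
      rw [two_mul, Real.rpow_add_of_nonneg (hf.nonneg θ₀ hθ₀ x) hβ hβ]
    rw [this, smul_eq_mul]
    simp only [ha]
    ring
  have haa : Integrable (fun x => a i x * a j x) ν ∧ ∫ x, a i x * a j x ∂ν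
      = ∫ x, score f θ₀ x i * score f θ₀ x j * f θ₀ x ^ (2 * β) * f θ₀ x ∂μ := by
    constructor
    · rw [integrable_withDensity_model_iff hf hθ₀]
      simp_rw [e]
      exact hK_fin i j
    · rw [integral_withDensity_model hf hθ₀]
      simp_rw [e]
  have hexp : (fun x => centeredScore f μ β θ₀ x i * centeredScore f μ β θ₀ x j)
      = fun x => a i x * a j x - (ξ j * a i x + ξ i * a j x - ξ i * ξ j) := by
    ext x
    simp only [centeredScore, ha, hξ]
    ring
  have h1 := (ha_int i).1.const_mul (ξ j)
  have h2 := (ha_int j).1.const_mul (ξ i)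
  have h12 : Integrable (fun x => ξ j * a i x + ξ i * a j x) ν := h1.add h2
  have h3 : Integrable (fun x => ξ j * a i x + ξ i * a j x - ξ i * ξ j) ν :=
    h12.sub (integrable_const (ξ i * ξ j))
  rw [hexp]
  refine ⟨haa.1.sub h3, ?_⟩
  rw [integral_sub haa.1 h3, haa.2]
  have h4 : ∫ x, (ξ j * a i x + ξ i * a j x - ξ i * ξ j) ∂ν = ξ i * ξ j := by
    rw [integral_sub h12 (integrable_const _), integral_add h1 h2, integral_const_mul,
      integral_const_mul, (ha_int i).2, (ha_int j).2]
    simp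
    ring
  rw [h4, matK, Matrix.of_apply, hξ', hξ']

lemma integral_inner_centeredScore_sq (hf : IsDensityModel f μ Θ) (hβ : 0 ≤ β)
    (hreg : RegularityConditions f μ Θ β (f θ₀) θ₀ ω)
    (hK_fin : ∀ i j, Integrable (fun x => score f θ₀ x i * score f θ₀ x j
      * f θ₀ x ^ (2 * β) * f θ₀ x) μ) (s : EuclideanSpace ℝ (Fin p)) :
    ∫ x, inner ℝ (centeredScore f μ β θ₀ x) s ^ 2
        ∂(μ.withDensity fun x => ENNReal.ofReal (f θ₀ x))
      = s.ofLp ⬝ᵥ (matK f μ β (f θ₀) θ₀).mulVec s.ofLp := by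
  have hK := integrable_integral_centeredScore_mul hf hβ hreg hK_fin
  have e : ∀ x, inner ℝ (centeredScore f μ β θ₀ x) s ^ 2 = ∑ i, ∑ j,
      s i * s j * (centeredScore f μ β θ₀ x i * centeredScore f μ β θ₀ x j) := by
    intro x
    rw [PiLp.inner_apply, pow_two, Finset.sum_mul_sum]
    refine Finset.sum_congr rfl fun i _ => Finset.sum_congr rfl fun j _ => ?_
    simp only [RCLike.inner_apply, conj_trivial]
    ring
  simp_rw [e]
  rw [integral_finsetSum _ fun i _ => integrable_finsetSum _ fun j _ => (hK i j).1.const_mul _]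
  simp_rw [integral_finsetSum _ fun j _ => (hK _ j).1.const_mul _, integral_const_mul, (hK _ _).2,
    dotProduct, Matrix.mulVec, dotProduct, Finset.mul_sum]
  refine Finset.sum_congr rfl fun i _ => Finset.sum_congr rfl fun j _ => ?_
  ring

lemma posSemidef_matK (hf : IsDensityModel f μ Θ) (hβ : 0 ≤ β)
    (hreg : RegularityConditions f μ Θ β (f θ₀) θ₀ ω)
    (hK_fin : ∀ i j, Integrable (fun x => score f θ₀ x i * score f θ₀ x j
      * f θ₀ x ^ (2 * β) * f θ₀ x) μ) : (matK f μ β (f θ₀) θ₀).PosSemidef := by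
  refine Matrix.PosSemidef.of_dotProduct_mulVec_nonneg ?_ fun s => ?_
  · refine Matrix.IsHermitian.ext fun i j => ?_
    rw [star_trivial, ← (integrable_integral_centeredScore_mul hf hβ hreg hK_fin i j).2,
      ← (integrable_integral_centeredScore_mul hf hβ hreg hK_fin j i).2]
    simp_rw [mul_comm]
  · rw [star_trivial]
    have := integral_inner_centeredScore_sq hf hβ hreg hK_fin (WithLp.toLp 2 s)
    rw [← this]
    exact integral_nonneg fun x => sq_nonneg _

end Model

/-! ### The model yields a regular estimating family. -/

section Model

open Matrix

variable {p : ℕ} {𝓧 : Type*} [MeasurableSpace 𝓧] {μ : Measure 𝓧}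
  {f : EuclideanSpace ℝ (Fin p) → 𝓧 → ℝ} {Θ ω : Set (EuclideanSpace ℝ (Fin p))}
  {θ₀ θ : EuclideanSpace ℝ (Fin p)} {β : ℝ}

lemma integrable_dominating (hf : IsDensityModel f μ Θ)
    (hreg : RegularityConditions f μ Θ β (f θ₀) θ₀ ω) :
    ∃ M : 𝓧 → ℝ, Integrable M (μ.withDensity fun x => ENNReal.ofReal (f θ₀ x)) ∧
      ∀ᵐ x ∂(μ.withDensity fun x => ENNReal.ofReal (f θ₀ x)), ∀ θ ∈ ω,
        ‖iteratedFDeriv ℝ 3 (fun t => lossV f μ β t x) θ‖ ≤ M x := by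
  obtain ⟨M, hM, hbound⟩ := hreg.dominated
  refine ⟨M, ?_, ae_withDensity_model hf (hreg.subset hreg.mem) hbound⟩
  rw [integrable_withDensity_model_iff hf (hreg.subset hreg.mem)]
  simpa only [smul_eq_mul, mul_comm] using hM

/-- A linear image of the centred score of a regular model is a regular family of estimating
functions. -/
theorem regularEstimatingFamily_centeredScore (hf : IsDensityModel f μ Θ) (hβ : 0 ≤ β)
    (hreg : RegularityConditions f μ Θ β (f θ₀) θ₀ ω) (R : Matrix (Fin p) (Fin p) ℝ) {r : ℝ}
    (hr : 0 < r) (hrω : Metric.closedBall θ₀ r ⊆ ω)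
    {A : EuclideanSpace ℝ (Fin p) ≃L[ℝ] EuclideanSpace ℝ (Fin p)}
    (hA : (A : EuclideanSpace ℝ (Fin p) →L[ℝ] EuclideanSpace ℝ (Fin p))
      = toEuclideanCLM (𝕜 := ℝ) (-(R * matJ f μ β (f θ₀) θ₀))) :
    RegularEstimatingFamily
      (fun θ x => toEuclideanCLM (𝕜 := ℝ) R (centeredScore f μ β θ x))
      (μ.withDensity fun x => ENNReal.ofReal (f θ₀ x)) θ₀ r A := by
  have hβ1 : 1 + β ≠ 0 := by positivity
  have hint : Integrable (centeredScore f μ β θ₀)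
      (μ.withDensity fun x => ENNReal.ofReal (f θ₀ x)) :=
    Integrable.of_eval_piLp fun i => (integrable_integral_centeredScore hf hβ hreg i).1
  refine ⟨hr, fun θ hθ => ?_, ?_, ?_, ?_⟩
  · exact (toEuclideanCLM (𝕜 := ℝ) R).continuous.measurable.comp_aemeasurable
      (aemeasurable_centeredScore hf hβ hreg (hrω hθ))
  · exact (toEuclideanCLM (𝕜 := ℝ) R).integrable_comp hint
  · rw [ContinuousLinearMap.integral_comp_comm _ hint]
    suffices h : ∫ x, centeredScore f μ β θ₀ x
        ∂(μ.withDensity fun x => ENNReal.ofReal (f θ₀ x)) = 0 by rw [h, map_zero]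
    ext i
    rw [eval_integral_piLp fun i => (integrable_integral_centeredScore hf hβ hreg i).1]
    exact (integrable_integral_centeredScore hf hβ hreg i).2
  -- The scalar undoes the factor -(1+β) between the gradient of the loss and the centred score; L
  -- then sends the mean Hessian, with matrix (1+β) J, to -(R J).
  · set L : (EuclideanSpace ℝ (Fin p) →L[ℝ] ℝ) →L[ℝ] EuclideanSpace ℝ (Fin p) :=
      (-(1 + β)⁻¹) • (toEuclideanCLM (𝕜 := ℝ) R ∘L coordMap p) with hL
    obtain ⟨M, hM, hbound⟩ := integrable_dominating hf hreg
    obtain ⟨hH, hHint⟩ := integrable_integral_hessian_lossV hf hβ hreg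
    refine ⟨fun x => L ∘L fderiv ℝ (fderiv ℝ fun t => lossV f μ β t x) θ₀, fun x => ‖L‖ * M x,
      ?_, ?_, hM.const_mul _, ?_⟩
    · exact ((ContinuousLinearMap.compL ℝ (EuclideanSpace ℝ (Fin p))
        (EuclideanSpace ℝ (Fin p) →L[ℝ] ℝ) (EuclideanSpace ℝ (Fin p))) L).integrable_comp hH
    · have h1 := ((ContinuousLinearMap.compL ℝ (EuclideanSpace ℝ (Fin p))
        (EuclideanSpace ℝ (Fin p) →L[ℝ] ℝ) (EuclideanSpace ℝ (Fin p))) L).integral_comp_comm hH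
      simp only [ContinuousLinearMap.compL_apply] at h1
      rw [h1, hHint, hA]
      have h2 := coordMap_comp_eq_toEuclideanCLM (J := (1 + β) • matJ f μ β (f θ₀) θ₀)
        (integral_scoreForm_apply hf hβ hreg)
      rw [hL, ContinuousLinearMap.smul_comp, ContinuousLinearMap.comp_assoc, h2, map_smul,
        ContinuousLinearMap.comp_smul, smul_smul, map_neg, map_mul, neg_mul,
        inv_mul_cancel₀ hβ1, neg_one_smul]
      rfl
    · filter_upwards [ae_contDiffOn_and_pos hf hreg, hbound] with x hx hMx ρ hρ θ hθ θ' hθ'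
      have hsub : Metric.closedBall θ₀ ρ ⊆ ω :=
        (Metric.closedBall_subset_closedBall hρ).trans hrω
      have key := (lossV_regular hf hreg hx.1 hx.2).1.norm_fderiv_sub_sub_le hMx hsub hθ hθ'
      have hψ : ∀ t ∈ Metric.closedBall θ₀ ρ, toEuclideanCLM (𝕜 := ℝ) R (centeredScore f μ β t x)
          = L (fderiv ℝ (fun t => lossV f μ β t x) t) := by
        intro t ht
        rw [hL, _root_.smul_apply, ContinuousLinearMap.comp_apply,
          coordMap_fderiv_lossV hf hβ hreg hx.1 hx.2 (hsub ht), map_smul, smul_smul, neg_mul_neg,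
          inv_mul_cancel₀ hβ1, one_smul]
      rw [hψ θ hθ, hψ θ' hθ', ContinuousLinearMap.comp_apply, ← map_sub, ← map_sub, mul_assoc,
        mul_assoc, ← mul_assoc (M x)]
      exact L.le_opNorm_of_le key

end Model

/-! ### Minimizers, roots, and the limit of the Wald statistic. -/

section Estimators

open Matrix

variable {p : ℕ} {𝓧 Ω : Type*} [MeasurableSpace 𝓧] [MeasurableSpace Ω] {μ : Measure 𝓧}
  {f : EuclideanSpace ℝ (Fin p) → 𝓧 → ℝ} {Θ ω : Set (EuclideanSpace ℝ (Fin p))}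
  {θ₀ θ : EuclideanSpace ℝ (Fin p)} {β : ℝ} {P : Measure Ω} {X : ℕ → Ω → 𝓧}
  {T : (n : ℕ) → (Fin n → 𝓧) → EuclideanSpace ℝ (Fin p)}

/-- A minimizer of the empirical objective function in the interior of the parameter set solves
the estimating equation. -/
lemma estimatingFun_eq_zero_of_isMinOn (hf : IsDensityModel f μ Θ) (hβ : 0 ≤ β)
    (hreg : RegularityConditions f μ Θ β (f θ₀) θ₀ ω) {n : ℕ} (hn : n ≠ 0) {x : Fin n → 𝓧}
    (hx : ∀ i, ContDiffOn ℝ 3 (fun t => f t (x i)) ω ∧ ∀ θ ∈ ω, 0 < f θ (x i)) (hθ : θ ∈ ω)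
    (hmin : IsMinOn (empObjective f μ β x) Θ θ) : estimatingFun f μ β x θ = 0 := by
  have hloc : IsLocalMin (empObjective f μ β x) θ :=
    hmin.isLocalMin (mem_of_superset (hreg.isOpen.mem_nhds hθ) hreg.subset)
  have hd : HasFDerivAt (empObjective f μ β x)
      ((1 / (n : ℝ)) • ∑ i, fderiv ℝ (fun t => lossV f μ β t (x i)) θ) θ := by
    refine HasFDerivAt.const_mul (HasFDerivAt.fun_sum fun i _ => ?_) _
    exact ((lossV_regular hf hreg (hx i).1 (hx i).2).1 θ hθ).1.hasFDerivAt
  have h0 := congrArg (coordMap p) (hloc.hasFDerivAt_eq_zero hd)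
  have h1 : empMean (centeredScore f μ β θ) x = 0 := by
    rw [map_smul, map_sum, map_zero] at h0
    simp only [coordMap_fderiv_lossV hf hβ hreg (hx _).1 (hx _).2 hθ] at h0
    rw [← Finset.smul_sum, smul_comm, one_div] at h0
    exact (smul_eq_zero.1 h0).resolve_left (neg_ne_zero.2 (by positivity))
  rw [← ofLp_empMean_centeredScore f μ β hn, h1]
  rfl

/-- Consistency places the minimizer in a ball inside ω ⊆ Θ, where it is an interior minimum and the
gradient vanishes. -/
lemma IsConsistentMinimizerSeq.isConsistentRootSeq (hf : IsDensityModel f μ Θ) (hβ : 0 ≤ β)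
    (hreg : RegularityConditions f μ Θ β (f θ₀) θ₀ ω)
    (hX_law : ∀ i, HasLaw (X i) (μ.withDensity (fun x => ENNReal.ofReal (f θ₀ x))) P)
    (hT : IsConsistentMinimizerSeq f μ Θ β θ₀ P X T) : IsConsistentRootSeq f μ Θ β θ₀ P X T := by
  refine ⟨hT.measurable, ?_, hT.consistent⟩
  obtain ⟨r, hr, hrω⟩ := Metric.isOpen_iff.1 hreg.isOpen θ₀ hreg.mem
  have hclose := tendstoInMeasure_iff_withHighProb.1 hT.consistent r hr
  have hmin : WithHighProb P (fun n w => T n (sample X n w) ∈ Θ ∧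
      IsMinOn (empObjective f μ β (sample X n w)) Θ (T n (sample X n w))) := hT.tendsto_prob
  refine (hmin.and hclose).mono_ae ?_
  filter_upwards [eventually_ne_atTop 0] with n hn
  filter_upwards [ae_forall_sample hX_law (ae_contDiffOn_and_pos hf hreg)] with w hw
  rintro ⟨⟨h1, h2⟩, h3⟩
  refine ⟨h1, estimatingFun_eq_zero_of_isMinOn hf hβ hreg hn (fun i => hw i) (hrω ?_) h2⟩
  rwa [mem_ball_iff_norm]

theorem exists_isConsistentRootSeq [IsProbabilityMeasure P] (hf : IsDensityModel f μ Θ)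
    (hβ : 0 ≤ β) (hreg : RegularityConditions f μ Θ β (f θ₀) θ₀ ω) (hX_indep : iIndepFun X P)
    (hX_law : ∀ i, HasLaw (X i) (μ.withDensity (fun x => ENNReal.ofReal (f θ₀ x))) P) :
    ∃ T : (n : ℕ) → (Fin n → 𝓧) → EuclideanSpace ℝ (Fin p),
      IsConsistentRootSeq f μ Θ β θ₀ P X T := by
  obtain ⟨r, hr, hrω⟩ := Metric.nhds_basis_closedBall.mem_iff.1 (hreg.isOpen.mem_nhds hreg.mem)
  -- Existence needs no whitening, so R = 1.
  obtain ⟨A, hA⟩ := exists_continuousLinearEquiv_toEuclideanCLM (B := -(1 * matJ f μ β (f θ₀) θ₀))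
    (by simpa using hreg.posDef.isUnit)
  obtain ⟨T, hTm, hTroot, hTcons⟩ := (regularEstimatingFamily_centeredScore hf hβ hreg 1 hr hrω
    hA).exists_consistent_roots hX_indep hX_law
  refine ⟨T, hTm, ?_, hTcons⟩
  refine hTroot.mono_ae ?_
  filter_upwards [eventually_ne_atTop 0] with n hn
  refine ae_of_all _ fun w hw => ⟨hreg.subset (hrω hw.1), ?_⟩
  have h := hw.2
  simp only [map_one, one_apply_eq_self] at h
  rw [← ofLp_empMean_centeredScore f μ β hn]
  exact congrArg WithLp.ofLp h

theorem tendstoInDistribution_waldStat [IsProbabilityMeasure P] (hf : IsDensityModel f μ Θ)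
    (hβ : 0 ≤ β) (hreg : RegularityConditions f μ Θ β (f θ₀) θ₀ ω)
    (hK_fin : ∀ i j, Integrable (fun x => score f θ₀ x i * score f θ₀ x j
      * f θ₀ x ^ (2 * β) * f θ₀ x) μ)
    (hK_inv : IsUnit (matK f μ β (f θ₀) θ₀)) (hX_indep : iIndepFun X P)
    (hX_law : ∀ i, HasLaw (X i) (μ.withDensity (fun x => ENNReal.ofReal (f θ₀ x))) P)
    (hT : IsConsistentRootSeq f μ Θ β θ₀ P X T) :
    TendstoInDistribution
      (fun (n : ℕ) w => waldStat (matJ f μ β (f θ₀) θ₀) (matK f μ β (f θ₀) θ₀) θ₀ n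
        (T n (sample X n w)))
      atTop (id : ℝ → ℝ) (fun _ => P) (chiSquared p) := by
  obtain ⟨R, hRK, hRKR⟩ := exists_whitening (posSemidef_matK hf hβ hreg hK_fin) hK_inv
  obtain ⟨r, hr, hrω⟩ := Metric.nhds_basis_closedBall.mem_iff.1 (hreg.isOpen.mem_nhds hreg.mem)
  have hJ := hreg.posDef
  have hRu : IsUnit R := by
    rw [Matrix.mul_assoc] at hRKR
    exact IsUnit.of_mul_eq_one _ hRKR
  obtain ⟨A, hA⟩ := exists_continuousLinearEquiv_toEuclideanCLM (B := -(R * matJ f μ β (f θ₀) θ₀))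
    (hRu.mul hJ.isUnit).neg
  have hfam := regularEstimatingFamily_centeredScore hf hβ hreg R hr hrω hA
  have hcov : ∀ t, ∫ x, inner ℝ (toEuclideanCLM (𝕜 := ℝ) R (centeredScore f μ β θ₀ x)) t ^ 2
      ∂(μ.withDensity fun x => ENNReal.ofReal (f θ₀ x)) = ‖t‖ ^ 2 := by
    -- Moving R to the other side gives the variance ⟨Rᵀt, K Rᵀt⟩ = ⟨t, R K Rᵀ t⟩ = ‖t‖².
    intro t
    have e : ∀ y, inner ℝ (toEuclideanCLM (𝕜 := ℝ) R y) t
        = inner ℝ y (toEuclideanCLM (𝕜 := ℝ) Rᵀ t) := by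
      intro y
      rw [inner_toEuclideanCLM, real_inner_comm, inner_toEuclideanCLM, mulVec_transpose,
        dotProduct_mulVec, dotProduct_comm]
    simp_rw [e]
    rw [integral_inner_centeredScore_sq hf hβ hreg hK_fin, ofLp_toEuclideanCLM,
      ← real_inner_self_eq_norm_sq, EuclideanSpace.inner_eq_star_dotProduct, star_trivial,
      mulVec_transpose, ← dotProduct_mulVec, mulVec_mulVec, ← mulVec_transpose, mulVec_mulVec,
      hRKR, one_mulVec]
  have hroot : WithHighProb P (fun n w => T n (sample X n w) ∈ Θ ∧
      estimatingFun f μ β (sample X n w) (T n (sample X n w)) = 0) := hT.tendsto_prob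
  have hlim := hfam.tendstoInDistribution_roots hX_indep hX_law hcov hT.measurable
    (hroot.mono_ae ?_) hT.consistent
  · have hcomp := hlim.continuous_comp (g := fun z : EuclideanSpace ℝ (Fin p) => ‖z‖ ^ 2)
      (by fun_prop)
    have hJT : (matJ f μ β (f θ₀) θ₀)ᵀ = matJ f μ β (f θ₀) θ₀ := by
      rw [← conjTranspose_eq_transpose_of_trivial]
      exact hJ.isHermitian
    have heq : (fun (n : ℕ) w => waldStat (matJ f μ β (f θ₀) θ₀) (matK f μ β (f θ₀) θ₀) θ₀ n
        (T n (sample X n w))) = fun (n : ℕ) => (fun z : EuclideanSpace ℝ (Fin p) => ‖z‖ ^ 2) ∘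
          fun w => -(√(n : ℝ) • A (T n (sample X n w) - θ₀)) := by
      ext n w
      rw [waldStat_eq_norm_sq hJT hJ.isUnit hRK, ← hA]
      rfl
    rw [heq]
    refine ⟨hcomp.forall_aemeasurable, aemeasurable_id, ?_⟩
    convert hcomp.tendsto using 2
    ext1
    simp [chiSquared]
  · filter_upwards [eventually_ne_atTop 0] with n hn
    refine ae_of_all _ fun w hw => ?_
    have h : empMean (centeredScore f μ β (T n (sample X n w))) (sample X n w) = 0 := by
      apply WithLp.ofLp_injective
      rw [ofLp_empMean_centeredScore f μ β hn]
      exact hw.2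
    -- R commutes with the mean, so roots of the original equation are roots of the whitened one.
    have h2 : empMean (fun x => toEuclideanCLM (𝕜 := ℝ) R
          (centeredScore f μ β (T n (sample X n w)) x)) (sample X n w)
        = toEuclideanCLM (𝕜 := ℝ) R
          (empMean (centeredScore f μ β (T n (sample X n w))) (sample X n w)) := by
      simp only [empMean, map_smul, map_sum]
    rw [h2, h, map_zero]

end Estimators

end WaldDPD

end

theorem theorem1 {p : ℕ} {𝓧 : Type*} [MeasurableSpace 𝓧] (μ : Measure 𝓧)
    (Θ : Set (EuclideanSpace ℝ (Fin p))) (f : EuclideanSpace ℝ (Fin p) → 𝓧 → ℝ)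
    (hf : WaldDPD.IsDensityModel f μ Θ)
    (β : ℝ) (hβ : 0 ≤ β)
    (θ₀ : EuclideanSpace ℝ (Fin p)) (ω : Set (EuclideanSpace ℝ (Fin p)))
    (hreg : WaldDPD.RegularityConditions f μ Θ β (f θ₀) θ₀ ω)
    (hK_fin : ∀ i j, Integrable (fun x => WaldDPD.score f θ₀ x i * WaldDPD.score f θ₀ x j
      * f θ₀ x ^ (2 * β) * f θ₀ x) μ)
    (hK_inv : IsUnit (WaldDPD.matK f μ β (f θ₀) θ₀))
    {Ω : Type*} [MeasurableSpace Ω] (P : Measure Ω) [IsProbabilityMeasure P]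
    (X : ℕ → Ω → 𝓧) (hX_indep : iIndepFun X P)
    (hX_law : ∀ i, HasLaw (X i) (μ.withDensity (fun x => ENNReal.ofReal (f θ₀ x))) P) :
    (∃ T : (n : ℕ) → (Fin n → 𝓧) → EuclideanSpace ℝ (Fin p),
      WaldDPD.IsConsistentRootSeq f μ Θ β θ₀ P X T) ∧
    ∀ T : (n : ℕ) → (Fin n → 𝓧) → EuclideanSpace ℝ (Fin p),
      (WaldDPD.IsConsistentRootSeq f μ Θ β θ₀ P X T ∨
        WaldDPD.IsConsistentMinimizerSeq f μ Θ β θ₀ P X T) →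
      TendstoInDistribution
        (fun (n : ℕ) w => WaldDPD.waldStat (WaldDPD.matJ f μ β (f θ₀) θ₀)
          (WaldDPD.matK f μ β (f θ₀) θ₀) θ₀ n (T n (WaldDPD.sample X n w)))
        atTop (id : ℝ → ℝ) (fun _ => P) (WaldDPD.chiSquared p)
 := by
  refine ⟨WaldDPD.exists_isConsistentRootSeq hf hβ hreg hX_indep hX_law, fun T hT => ?_⟩
  refine WaldDPD.tendstoInDistribution_waldStat hf hβ hreg hK_fin hK_inv hX_indep hX_law ?_
  rcases hT with hT | hT
  · exact hT
  · exact WaldDPD.IsConsistentMinimizerSeq.isConsistentRootSeq hf hβ hreg hX_law hT
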